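/- For a finite group $G$, a positive integer $n$ dividing $|G|$ and real numbers $r,s$, let $o(x)$ denote the order of $x\in G$, let $\varphi$ be Euler's totient function, and set $$R_{G,n}(r,s)=\sum_{x\in G,\ o(x)\mid n}\frac{o(x)^s}{\varphi(o(x))^r},\qquad T_{G,n}(r,s)=R_{G,n}(r,s)-R_{C_{|G|},n}(r,s),$$ where $C_{|G|}$ is the cyclic group of order $|G|$, and $T_G(r,s)=T_{G,|G|}(r,s)$. Let $G$ be a finite group, $n$ a divisor of $|G|$, and $r,s\in\mathbb{R}$. Then: 1. If $s<r$ and $s\le 0$, then $T_{G,n}(r,s)\ge 0$, with equality if and only if for every divisor $m$ of $n$ the group $G$ has exactly one cyclic subgroup of order $m$. 2. If $s=r<0$, then $T_{G,n}(r,s)\ge 0$, with equality if and only if $G$ has exactly one subgroup of order $n$ and that subgroup is nilpotent. 3. If $r\le s-1$ and $s\ge 1$, then $T_G(r,s)\le 0$, with equality if and only if $G$ is cyclic. 4. If $G$ is nilpotent and not cyclic, then $T_G(r,s)$ and $r-s$ have the same sign (both positive, both zero, or both negative). -/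

import Mathlib

/-- The standard cyclic group of order `|G|`, written multiplicatively. -/
abbrev CyclicModel (G : Type*) [Fintype G] : Type :=
  Multiplicative (ZMod (Fintype.card G))

instance cyclicModelFintype (G : Type*) [Group G] [Fintype G] : Fintype (CyclicModel G) :=
  haveI : NeZero (Fintype.card G) := ⟨Fintype.card_ne_zero⟩
  inferInstanceAs (Fintype (Multiplicative (ZMod (Fintype.card G))))

/-- `R_{G,n}(r,s) = ∑_{x ∈ G, o(x) ∣ n} o(x)^s / φ(o(x))^r`. -/
noncomputable def RSum (G : Type*) [Group G] [Fintype G] (n : ℕ) (r s : ℝ) : ℝ :=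
  ∑ x : G with orderOf x ∣ n,
    (orderOf x : ℝ) ^ s / (Nat.totient (orderOf x) : ℝ) ^ r

/-- `T_{G,n}(r,s) = R_{G,n}(r,s) - R_{C,n}(r,s)`, where `C` is the cyclic group of order `|G|`. -/
noncomputable def TDiff (G : Type*) [Group G] [Fintype G] (n : ℕ) (r s : ℝ) : ℝ :=
  RSum G n r s - RSum (CyclicModel G) n r s

/-- `T_G(r,s) = T_{G,|G|}(r,s)`. -/
noncomputable def TDiffTotal (G : Type*) [Group G] [Fintype G] (r s : ℝ) : ℝ :=
  TDiff G (Fintype.card G) r s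

/-! Write N(m) for the number of solutions of x^m = 1 in G and f(d) = d^s/φ(d)^r, a multiplicative
function. Möbius inversion on the divisors of n gives T_{G,n} = ∑_{m∣n} w(m)(N(m) - m), where w(m)
is a product over primes p∣n of the differences f(p^i) - f(p^{i+1}), or of f(p^i) alone when i is
the full exponent of p in n. By Frobenius's theorem (`dvd_powOneCount`) every N(m) - m is
nonnegative, so the first two claims reduce to the signs of the weights.

If s < r and s ≤ 0, f does not increase along prime powers and w(m) is positive, except possibly
when n is even and m is odd; that gap is closed by `powOneCount_le_of_odd`. If s = r < 0, f drops
from 1 to p and is then constant, so the weights see only the m coprime to n/m. There N(m) = m makes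
the solution sets nilpotent subgroups (`exists_isNilpotent_of_powOneCount`), and conversely
`mem_of_pow_card_eq_one` reduces T to a nilpotent group, where it vanishes.

For nilpotent G both sums are products over primes, and each p-part differs from the cyclic one by 1
- p^{s-r} times a nonnegative quantity (`exists_primary_comparison`); this gives the sign.

If r ≤ s - 1 and s ≥ 1, f(d)/d is monotone for divisibility. If ∑ f(o(x)) reaches its cyclic value,
some cyclic subgroup has index below the largest prime p dividing |G|, so the Sylow p-subgroup is
cyclic and normal. Splitting it off and inducting on |G| shows that G is cyclic
(`isCyclic_of_cyclicSum_le`). -/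

/-! ### Frobenius's theorem on the solutions of x^m = 1 -/

/-- The number of solutions of `x ^ m = 1` in `G`. -/
noncomputable def powOneCount (G : Type*) [Group G] (m : ℕ) : ℕ :=
  Nat.card {x : G // x ^ m = 1}

/-- For coprime `a`, `b`, the elements killed by `a * b` are the products of commuting
elements killed by `a` and by `b`, in a unique way. -/
theorem exists_powOneEquiv {a b : ℕ} (hab : a.Coprime b) (G : Type*) [Group G] :
    ∃ e : {q : G × G // q.1 ^ a = 1 ∧ q.2 ^ b = 1 ∧ Commute q.1 q.2} ≃ {x : G // x ^ (a * b) = 1},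
      ∀ q, (e q : G) = q.1.1 * q.1.2 := by
  -- Idempotent exponents from the Chinese remainder theorem: x^u is the part of x killed by a, x^v
  -- the part killed by b.
  obtain ⟨u, hua, hub⟩ := Nat.chineseRemainder hab 1 0
  obtain ⟨v, hva, hvb⟩ := Nat.chineseRemainder hab 0 1
  have huv : u + v ≡ 1 [MOD a * b] :=
    (Nat.modEq_and_modEq_iff_modEq_mul hab).1 ⟨by simpa using hua.add hva, by simpa using hub.add hvb⟩
  have hbu : b ∣ u := (Nat.modEq_zero_iff_dvd).1 hub
  have hav : a ∣ v := (Nat.modEq_zero_iff_dvd).1 hva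
  refine ⟨⟨fun q => ⟨q.1.1 * q.1.2, ?_⟩,
    fun x => ⟨(x.1 ^ u, x.1 ^ v), ?_, ?_, ?_⟩, ?_, ?_⟩, fun q => rfl⟩
  · obtain ⟨⟨y, z⟩, hy, hz, hyz⟩ := q
    simp only at hy hz hyz ⊢
    rw [hyz.mul_pow, pow_mul, hy, mul_comm a b, pow_mul, hz, one_pow, one_pow, one_mul]
  · obtain ⟨c, rfl⟩ := hbu
    simp only
    rw [← pow_mul, show b * c * a = a * b * c by ring, pow_mul, x.2, one_pow]
  · obtain ⟨c, rfl⟩ := hav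
    simp only
    rw [← pow_mul, show a * c * b = a * b * c by ring, pow_mul, x.2, one_pow]
  · exact (Commute.refl _).pow_pow _ _
  · rintro ⟨⟨y, z⟩, hy, hz, hyz⟩
    simp only at hy hz hyz
    simp only [Subtype.mk.injEq, Prod.mk.injEq]
    constructor
    · rw [hyz.mul_pow, pow_eq_pow_of_modEq hua hy, pow_eq_pow_of_modEq hub hz]; simp
    · rw [hyz.mul_pow, pow_eq_pow_of_modEq hva hy, pow_eq_pow_of_modEq hvb hz]; simp
  · rintro ⟨x, hx⟩
    simp only [Subtype.mk.injEq]
    rw [← pow_add, pow_eq_pow_of_modEq huv hx, pow_one]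

-- Once the part z killed by b is fixed, the part killed by a ranges over the centralizer of z.
open Classical in
theorem powOneCount_mul {a b : ℕ} (hab : a.Coprime b) (G : Type*) [Group G] [Fintype G] :
    powOneCount G (a * b) =
      ∑ z : G, if z ^ b = 1 then powOneCount (Subgroup.centralizer {z}) a else 0 := by
  obtain ⟨e, -⟩ := exists_powOneEquiv hab G
  rw [powOneCount, ← Nat.card_congr e, ← Finset.sum_filter]
  have key : {q : G × G // q.1 ^ a = 1 ∧ q.2 ^ b = 1 ∧ Commute q.1 q.2} ≃
      Σ z : {z : G // z ^ b = 1}, {y : Subgroup.centralizer {z.1} // y ^ a = 1} :=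
    { toFun := fun q => ⟨⟨q.1.2, q.2.2.1⟩, ⟨⟨q.1.1, Subgroup.mem_centralizer_singleton_iff.2 q.2.2.2⟩,
        Subtype.ext q.2.1⟩⟩
      invFun := fun s => ⟨(s.2.1.1, s.1.1), by simpa using congrArg Subtype.val s.2.2, s.1.2,
        Subgroup.mem_centralizer_singleton_iff.1 s.2.1.2⟩
      left_inv := fun _ => rfl
      right_inv := fun _ => rfl }
  rw [Nat.card_congr key, Nat.card_sigma]
  exact (Finset.sum_subtype _ (by simp) (fun z => powOneCount (Subgroup.centralizer {z}) a)).symm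

/-- A sum of a class function `F` is divisible by `D` as soon as the contribution
`[G : C(z)] * F z` of every conjugacy class is. -/
theorem dvd_sum_of_dvd_index_centralizer_mul {G : Type*} [Group G] [Fintype G] (F : G → ℕ)
    (hF : ∀ g z, F (g * z * g⁻¹) = F z) (D : ℕ)
    (hD : ∀ z, D ∣ (Subgroup.centralizer {z}).index * F z) : D ∣ ∑ z, F z := by
  classical
  rw [← Finset.sum_fiberwise (s := Finset.univ) (g := fun z : G => ConjClasses.mk z)]
  refine Finset.dvd_sum fun c _ => ?_
  obtain ⟨z, rfl⟩ := ConjClasses.mk_surjective c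
  have h1 : ∀ w ∈ Finset.univ.filter (fun w => ConjClasses.mk w = ConjClasses.mk z), F w = F z := by
    intro w hw
    obtain ⟨g, rfl⟩ := isConj_iff.1 (ConjClasses.mk_eq_mk_iff_isConj.1 (Finset.mem_filter.1 hw).2.symm)
    exact hF g z
  rw [Finset.sum_congr rfl h1, Finset.sum_const, smul_eq_mul]
  have h2 : (Finset.univ.filter (fun w => ConjClasses.mk w = ConjClasses.mk z)).card =
      (Subgroup.centralizer {z}).index := by
    have h3 := ConjClasses.card_carrier z
    rw [← Nat.card_eq_fintype_card (α := MulAction.stabilizer _ _),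
      ← Subgroup.nat_card_centralizer_nat_card_stabilizer, ← Nat.card_eq_fintype_card (α := G),
      ← Subgroup.card_mul_index (Subgroup.centralizer {z}), Nat.mul_div_cancel_left _ Nat.card_pos] at h3
    rw [← h3, Fintype.card_subtype]
    congr 1
    ext w
    simp [ConjClasses.mem_carrier_iff_mk_eq]
  rw [h2]
  exact hD z

theorem powOneCount_congr {G H : Type*} [Group G] [Group H] (e : G ≃* H) (m : ℕ) :
    powOneCount G m = powOneCount H m :=
  Nat.card_congr (e.toEquiv.subtypeEquiv fun x => by
    rw [MulEquiv.toEquiv_eq_coe, MulEquiv.coe_toEquiv, ← map_pow, map_eq_one_iff e e.injective])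

theorem powOneCount_centralizer_conj {G : Type*} [Group G] (g z : G) (a : ℕ) :
    powOneCount (Subgroup.centralizer {g * z * g⁻¹}) a =
      powOneCount (Subgroup.centralizer {z}) a := by
  refine Nat.card_congr (Equiv.symm ?_)
  refine ⟨fun y => ⟨⟨g * y.1.1 * g⁻¹, ?_⟩, ?_⟩, fun y => ⟨⟨g⁻¹ * y.1.1 * g, ?_⟩, ?_⟩, ?_, ?_⟩
  · have := Subgroup.mem_centralizer_singleton_iff.1 y.1.2
    rw [Subgroup.mem_centralizer_singleton_iff]
    simp only [mul_assoc, inv_mul_cancel_left]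
    rw [← mul_assoc y.1.1 z, this, mul_assoc]
  · have h : (y.1.1) ^ a = 1 := by simpa using congrArg Subtype.val y.2
    ext
    simp [h]
  · have := Subgroup.mem_centralizer_singleton_iff.1 y.1.2
    rw [Subgroup.mem_centralizer_singleton_iff]
    have h2 := congrArg (fun t => g⁻¹ * t * g) this
    simpa [mul_assoc] using h2
  · have h : (y.1.1) ^ a = 1 := by simpa using congrArg Subtype.val y.2
    ext
    have := conj_pow (i := a) (a := g⁻¹) (b := y.1.1)
    rw [inv_inv] at this
    simp [this, h]
  · intro y; ext; simp [mul_assoc]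
  · intro y; ext; simp [mul_assoc]

open Classical in
theorem dvd_powOneCount_mul {a b : ℕ} (hab : a.Coprime b) (G : Type*) [Group G] [Finite G] (D : ℕ)
    (hD : ∀ z : G, z ^ b = 1 → D ∣ (Subgroup.centralizer {z}).index *
      powOneCount (Subgroup.centralizer {z}) a) : D ∣ powOneCount G (a * b) := by
  have := Fintype.ofFinite G
  rw [powOneCount_mul hab]
  refine dvd_sum_of_dvd_index_centralizer_mul _ (fun g z => ?_) D fun z => ?_
  · rw [powOneCount_centralizer_conj]
    simp
  · split_ifs with h
    · exact hD z h
    · simp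

theorem powOneCount_card (G : Type*) [Group G] [Finite G] :
    powOneCount G (Nat.card G) = Nat.card G :=
  Nat.card_congr (Equiv.subtypeUnivEquiv fun _ => pow_card_eq_one')

theorem powOneCount_gcd (G : Type*) [Group G] [Finite G] (m : ℕ) :
    powOneCount G (m.gcd (Nat.card G)) = powOneCount G m := by
  refine Nat.card_congr (Equiv.subtypeEquivRight fun x => ?_)
  rw [← orderOf_dvd_iff_pow_eq_one, ← orderOf_dvd_iff_pow_eq_one, Nat.dvd_gcd_iff]
  exact and_iff_left (orderOf_dvd_natCard x)

theorem powOneCount_pos (G : Type*) [Group G] [Finite G] (m : ℕ) : 0 < powOneCount G m :=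
  haveI : Nonempty {x : G // x ^ m = 1} := ⟨⟨1, one_pow m⟩⟩
  Nat.card_pos

open Classical in
/-- Every cyclic subgroup of order `d` has `φ d` generators. -/
theorem card_filter_orderOf_eq (G : Type*) [Group G] [Fintype G] {d : ℕ} :
    (Finset.univ.filter fun x : G => orderOf x = d).card =
      d.totient * Nat.card {H : Subgroup G // IsCyclic H ∧ Nat.card H = d} := by
  rw [Finset.card_eq_sum_card_fiberwise (f := fun x : G => Subgroup.zpowers x)
    (t := Finset.univ.filter fun H : Subgroup G => IsCyclic H ∧ Nat.card H = d)]
  · rw [Nat.card_eq_fintype_card, Fintype.card_subtype, mul_comm, ← smul_eq_mul]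
    refine Finset.sum_const_nat fun H hH => ?_
    obtain ⟨hc, hd⟩ := (Finset.mem_filter.1 hH).2
    have hd' : Fintype.card H = d := by rw [← hd, Nat.card_eq_fintype_card]
    rw [← IsCyclic.card_orderOf_eq_totient (α := H) (d := d) (by rw [hd'])]
    symm
    refine Finset.card_bij (fun x _ => (x : G)) ?_ (fun _ _ _ _ h => Subtype.ext h) ?_
    · intro x hx
      have hx' : orderOf x = d := (Finset.mem_filter.1 hx).2
      simp only [Finset.mem_filter, Finset.mem_univ, true_and, Subgroup.orderOf_coe]
      refine ⟨hx', Subgroup.eq_of_le_of_card_ge (by simp) ?_⟩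
      rw [hd, Nat.card_zpowers, Subgroup.orderOf_coe, hx']
    · intro x hx
      simp only [Finset.mem_filter, Finset.mem_univ, true_and] at hx
      refine ⟨⟨x, hx.2 ▸ Subgroup.mem_zpowers x⟩, ?_, rfl⟩
      simpa [Subgroup.orderOf_mk] using hx.1
  · intro x hx
    have hx' : orderOf x = d := (Finset.mem_filter.1 hx).2
    simp only [Finset.coe_filter, Finset.mem_univ, true_and, Set.mem_ofPred_eq]
    exact ⟨inferInstance, by rw [Nat.card_zpowers, hx']⟩

open Classical in
theorem powOneCount_eq_card_filter (G : Type*) [Group G] [Fintype G] (m : ℕ) :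
    powOneCount G m = (Finset.univ.filter fun x : G => orderOf x ∣ m).card := by
  rw [powOneCount, Nat.card_eq_fintype_card, Fintype.card_subtype]
  simp only [orderOf_dvd_iff_pow_eq_one]

open Classical in
theorem powOneCount_eq_sum (G : Type*) [Group G] [Fintype G] {m : ℕ} (hm : m ≠ 0) :
    powOneCount G m = ∑ d ∈ m.divisors, (Finset.univ.filter fun x : G => orderOf x = d).card := by
  rw [powOneCount_eq_card_filter, Finset.card_eq_sum_card_fiberwise (f := fun x : G => orderOf x)
    (t := m.divisors)]
  · refine Finset.sum_congr rfl fun d hd => ?_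
    congr 1
    ext x
    simp only [Finset.mem_filter, Finset.mem_univ, true_and, and_iff_right_iff_imp]
    rintro rfl
    exact Nat.dvd_of_mem_divisors hd
  · intro x hx
    have hx' : orderOf x ∣ m := (Finset.mem_filter.1 hx).2
    simpa [hm] using hx'

/-- If the number of solutions of `x ^ p ^ k = 1` is divisible by `p ^ k` for the largest `p ^ k`
dividing the group order, then this holds for all smaller powers. -/
theorem pow_dvd_powOneCount_of_succ {p : ℕ} (hp : p.Prime) (G : Type*) [Group G] [Finite G] {k : ℕ}
    (h : p ^ (k + 1) ∣ powOneCount G (p ^ (k + 1))) : p ^ k ∣ powOneCount G (p ^ k) := by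
  classical
  have := Fintype.ofFinite G
  have h1 : powOneCount G (p ^ (k + 1)) = powOneCount G (p ^ k) +
      (Finset.univ.filter fun x : G => orderOf x = p ^ (k + 1)).card := by
    rw [powOneCount_eq_sum G (pow_ne_zero _ hp.ne_zero), powOneCount_eq_sum G (pow_ne_zero _ hp.ne_zero),
      Nat.sum_divisors_prime_pow hp, Nat.sum_divisors_prime_pow hp, Finset.sum_range_succ]
  -- Elements of order p^(k+1) come in packets of φ(p^(k+1)) = p^k(p-1), so p^k divides their
  -- number.
  rw [card_filter_orderOf_eq, Nat.totient_prime_pow_succ hp, mul_assoc] at h1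
  have h2 : p ^ k ∣ powOneCount G (p ^ (k + 1)) := (pow_dvd_pow p k.le_succ).trans h
  rw [h1] at h2
  exact (Nat.dvd_add_left (dvd_mul_right _ _)).1 h2

/-- D divides both [G:C]·D and [G:C]·|C| = |G|, hence [G:C]·gcd(D,|C|). -/
theorem dvd_index_mul_of_gcd_dvd {G : Type*} [Group G] [Finite G] (C : Subgroup G) {D N : ℕ}
    (hD : D ∣ Nat.card G) (h : D.gcd (Nat.card C) ∣ N) : D ∣ C.index * N := by
  refine dvd_trans ?_ (mul_dvd_mul_left C.index h)
  rw [← Nat.gcd_mul_left, mul_comm C.index (Nat.card C), C.card_mul_index]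
  exact Nat.dvd_gcd (dvd_mul_left _ _) hD

/-- In an abelian group the solutions form the kernel of the b-th power map; Cauchy's theorem would
give it an element of order p. -/
theorem not_dvd_powOneCount_of_comm {p b : ℕ} (hp : p.Prime) (hb : ¬ p ∣ b) (A : Type*) [Group A]
    [Finite A] (hA : ∀ x y : A, x * y = y * x) : ¬ p ∣ powOneCount A b := by
  intro h
  have := Fact.mk hp
  let _ : CommGroup A := { mul_comm := hA }
  have h1 : powOneCount A b = Nat.card (powMonoidHom b : A →* A).ker := rfl
  rw [h1] at h
  obtain ⟨x, hx⟩ := exists_prime_orderOf_dvd_card' p h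
  have h2 : x ^ b = 1 := by
    ext
    exact x.2
  exact hb (hx ▸ orderOf_dvd_of_pow_eq_one h2)

theorem card_filter_mem_and_pow_eq_one {G : Type*} [Group G] [Fintype G] (H : Subgroup G) (b : ℕ)
    [DecidablePred fun z : G => z ∈ H ∧ z ^ b = 1] :
    (Finset.univ.filter fun z : G => z ∈ H ∧ z ^ b = 1).card = powOneCount H b := by
  rw [← Fintype.card_subtype, ← Nat.card_eq_fintype_card]
  refine Nat.card_congr ⟨fun z => ⟨⟨z.1, z.2.1⟩, ?_⟩, fun z => ⟨z.1.1, z.1.2, ?_⟩, fun _ => rfl,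
    fun _ => rfl⟩
  · ext
    simpa using z.2.2
  · simpa using congrArg Subtype.val z.2

/-- Induction on |G| = p^v b. Count G itself by the parts z killed by b: noncentral z have smaller
centralizers, and by induction their classes contribute multiples of p^v. Each central z contributes
N(p^v), and the number of such z is prime to p, so p^v divides N(p^v). Smaller exponents follow by
descent, and larger ones give the same count as p^v. -/
theorem gcd_prime_pow_dvd_powOneCount {p : ℕ} (hp : p.Prime) (G : Type*) [Group G] [Finite G] (k : ℕ) :
    (p ^ k).gcd (Nat.card G) ∣ powOneCount G (p ^ k) := by
  classical
  induction hn : Nat.card G using Nat.strong_induction_on generalizing G k with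
  | _ n ih =>
  subst hn
  have := Fintype.ofFinite G
  obtain ⟨v, b, hb, hvb⟩ := Nat.exists_eq_pow_mul_and_not_dvd (n := Nat.card G) Nat.card_pos.ne' p hp.ne_one
  have hco : (p ^ v).Coprime b := Nat.Coprime.pow_left _ ((Nat.Prime.coprime_iff_not_dvd hp).2 hb)
  have hvG : p ^ v ∣ Nat.card G := hvb ▸ dvd_mul_right _ _
  have htop : p ^ v ∣ powOneCount G (p ^ v) := by
    have h1 := powOneCount_mul hco G
    rw [← hvb, powOneCount_card] at h1
    have h2 : ∀ z : G, (if z ^ b = 1 then powOneCount (Subgroup.centralizer {z}) (p ^ v) else 0) =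
        (if z ∈ Subgroup.center G then 0 else
          if z ^ b = 1 then powOneCount (Subgroup.centralizer {z}) (p ^ v) else 0) +
        (if z ∈ Subgroup.center G ∧ z ^ b = 1 then powOneCount G (p ^ v) else 0) := by
      intro z
      by_cases hz : z ∈ Subgroup.center G
      · have h3 : Subgroup.centralizer {z} = ⊤ := Subgroup.centralizer_eq_top_iff_subset.2 (by simpa using hz)
        rw [h3, powOneCount_congr Subgroup.topEquiv]
        simp [hz]
      · simp [hz]
    rw [Finset.sum_congr rfl fun z _ => h2 z] at h1
    rw [Finset.sum_add_distrib] at h1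
    have h4 : p ^ v ∣ ∑ z : G, (if z ∈ Subgroup.center G then 0 else
          if z ^ b = 1 then powOneCount (Subgroup.centralizer {z}) (p ^ v) else 0) := by
      refine dvd_sum_of_dvd_index_centralizer_mul _ (fun g z => ?_) _ fun z => ?_
      · rw [powOneCount_centralizer_conj]
        have h5 : g * z * g⁻¹ ∈ Subgroup.center G ↔ z ∈ Subgroup.center G := by
          refine ⟨fun h => ?_, fun h => Subgroup.Normal.conj_mem inferInstance z h g⟩
          have := Subgroup.Normal.conj_mem (H := Subgroup.center G) inferInstance _ h g⁻¹
          simpa [mul_assoc] using this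
        simp [h5]
      · split_ifs with hz hz'
        · simp
        · refine dvd_index_mul_of_gcd_dvd _ hvG (ih _ ?_ _ _ rfl)
          have h6 : Subgroup.centralizer {z} ≠ ⊤ := fun h =>
            hz (by simpa using Subgroup.centralizer_eq_top_iff_subset.1 h)
          refine lt_of_le_of_ne (Subgroup.card_le_card_group _) fun h => h6 ?_
          exact Subgroup.eq_top_of_card_eq _ h
        · simp
    rw [h1, Nat.dvd_add_right h4, ← Finset.sum_filter, Finset.sum_const, smul_eq_mul] at hvG
    refine Nat.Coprime.dvd_of_dvd_mul_left ?_ hvG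
    refine Nat.Coprime.pow_left _ ((Nat.Prime.coprime_iff_not_dvd hp).2 ?_)
    rw [card_filter_mem_and_pow_eq_one]
    exact not_dvd_powOneCount_of_comm hp hb _ fun x y =>
      Subtype.ext (Subgroup.mem_center_iff.1 y.2 x)
  have hle : ∀ j ≤ v, p ^ j ∣ powOneCount G (p ^ j) := fun j hj =>
    Nat.decreasingInduction (motive := fun j _ => p ^ j ∣ powOneCount G (p ^ j))
      (fun _ _ h => pow_dvd_powOneCount_of_succ hp G h) htop hj
  rw [← powOneCount_gcd]
  obtain ⟨j, -, hj⟩ := (Nat.dvd_prime_pow hp).1 (Nat.gcd_dvd_left (p ^ k) (Nat.card G))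
  rw [hj]
  refine hle j ?_
  have h8 : p ^ j ∣ p ^ v * b := hvb ▸ hj ▸ Nat.gcd_dvd_right _ _
  exact (Nat.pow_dvd_pow_iff_le_right hp.one_lt).1 (Nat.Coprime.dvd_of_dvd_mul_right
    (Nat.Coprime.pow_left _ ((Nat.Prime.coprime_iff_not_dvd hp).2 hb)) h8)

/-- **Theorem of Frobenius**: if `m` divides the order of `G` then it divides the number of solutions
of `x ^ m = 1`. -/
theorem dvd_powOneCount {G : Type*} [Group G] [Finite G] {m : ℕ} (hm : m ∣ Nat.card G) :
    m ∣ powOneCount G m := by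
  rw [Nat.dvd_iff_prime_pow_dvd_dvd]
  intro p k hp hk
  have hm0 : m ≠ 0 := ne_zero_of_dvd_ne_zero Nat.card_pos.ne' hm
  obtain ⟨v, b, hb, rfl⟩ := Nat.exists_eq_pow_mul_and_not_dvd hm0 p hp.ne_one
  have hco : (p ^ v).Coprime b := Nat.Coprime.pow_left _ ((Nat.Prime.coprime_iff_not_dvd hp).2 hb)
  have hkv : p ^ k ∣ p ^ v := Nat.Coprime.dvd_of_dvd_mul_right
    (Nat.Coprime.pow_left _ ((Nat.Prime.coprime_iff_not_dvd hp).2 hb)) hk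
  -- Only the p-part of m needs checking, and it is checked inside the centralizer of each z killed
  -- by b.
  refine hkv.trans (dvd_powOneCount_mul hco G _ fun z _ => ?_)
  exact dvd_index_mul_of_gcd_dvd _ ((dvd_mul_right _ _).trans hm) (gcd_prime_pow_dvd_powOneCount hp _ _)

theorem le_powOneCount {G : Type*} [Group G] [Finite G] {m : ℕ} (hm : m ∣ Nat.card G) :
    m ≤ powOneCount G m :=
  Nat.le_of_dvd (powOneCount_pos G m) (dvd_powOneCount hm)

theorem powOneCount_of_isCyclic {G : Type*} [Group G] [Finite G] [IsCyclic G] {m : ℕ}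
    (hm : m ∣ Nat.card G) : powOneCount G m = m := by
  classical
  have := Fintype.ofFinite G
  refine le_antisymm ?_ (le_powOneCount hm)
  rw [powOneCount, Nat.card_eq_fintype_card, Fintype.card_subtype]
  exact IsCyclic.card_pow_eq_one_le (Nat.pos_of_dvd_of_pos hm Nat.card_pos)

/-! ### Möbius inversion over the divisors of n -/

theorem sum_divisors_mul_of_coprime {M : Type*} [AddCommMonoid M] {a b : ℕ} (hab : a.Coprime b)
    (g : ℕ → M) :
    ∑ d ∈ (a * b).divisors, g d = ∑ x ∈ a.divisors, ∑ y ∈ b.divisors, g (x * y) := by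
  rw [Nat.divisors_mul, Finset.mul_def, Finset.sum_image hab.mul_injOn_divisors, Finset.sum_product]

/-- The coefficients expressing a multiplicative function `f` on the divisors of `n` as a combination
of the indicator functions of the divisors of `m`, for `m ∣ n`. -/
noncomputable def divisorWeight (f : ℕ → ℝ) (n m : ℕ) : ℝ :=
  ∏ p ∈ n.primeFactors, (f (p ^ m.factorization p) -
    if m.factorization p < n.factorization p then f (p ^ (m.factorization p + 1)) else 0)

theorem divisorWeight_mul (f : ℕ → ℝ) {a b x y : ℕ} (hab : a.Coprime b) (ha : a ≠ 0) (hb : b ≠ 0)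
    (hx : x ∣ a) (hy : y ∣ b) :
    divisorWeight f (a * b) (x * y) = divisorWeight f a x * divisorWeight f b y := by
  have hx0 := ne_zero_of_dvd_ne_zero ha hx
  have hy0 := ne_zero_of_dvd_ne_zero hb hy
  rw [divisorWeight, hab.primeFactors_mul, Finset.prod_union hab.disjoint_primeFactors,
    divisorWeight, divisorWeight]
  congr 1
  · refine Finset.prod_congr rfl fun p hp => ?_
    have h1 : b.factorization p = 0 := Nat.factorization_eq_zero_of_not_dvd fun h =>
      (Nat.prime_of_mem_primeFactors hp).one_lt.ne'
        (Nat.eq_one_of_dvd_coprimes hab (Nat.dvd_of_mem_primeFactors hp) h)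
    have h2 : y.factorization p = 0 := Nat.le_zero.1 (h1 ▸ (Nat.factorization_le_iff_dvd hy0 hb).2 hy p)
    simp [Nat.factorization_mul, *]
  · refine Finset.prod_congr rfl fun p hp => ?_
    have h1 : a.factorization p = 0 := Nat.factorization_eq_zero_of_not_dvd fun h =>
      (Nat.prime_of_mem_primeFactors hp).one_lt.ne'
        (Nat.eq_one_of_dvd_coprimes hab h (Nat.dvd_of_mem_primeFactors hp))
    have h2 : x.factorization p = 0 := Nat.le_zero.1 (h1 ▸ (Nat.factorization_le_iff_dvd hx0 ha).2 hx p)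
    simp [Nat.factorization_mul, *]

theorem divisorWeight_prime_pow (f : ℕ → ℝ) {p : ℕ} (hp : p.Prime) {k : ℕ} (hk : k ≠ 0) (i : ℕ) :
    divisorWeight f (p ^ k) (p ^ i) = f (p ^ i) - if i < k then f (p ^ (i + 1)) else 0 := by
  rw [divisorWeight, Nat.primeFactors_prime_pow hk hp, Finset.prod_singleton]
  simp [hp.factorization_pow]

theorem sum_ite_sub_succ (g : ℕ → ℝ) {j k : ℕ} (hjk : j ≤ k) :
    ∑ i ∈ Finset.range (k + 1), (if j ≤ i then g i - (if i < k then g (i + 1) else 0) else 0) = g j := by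
  have h : ∑ i ∈ Finset.range k, (if j ≤ i then g i - g (i + 1) else 0) = g j - g k := by
    induction k, hjk using Nat.le_induction with
    | base =>
      rw [sub_self]
      exact Finset.sum_eq_zero fun i hi => if_neg (by simpa using hi)
    | succ k hk ih => rw [Finset.sum_range_succ, ih, if_pos hk]; ring
  rw [Finset.sum_range_succ, if_pos hjk, if_neg (lt_irrefl k)]
  have h' : ∑ i ∈ Finset.range k, (if j ≤ i then g i - (if i < k then g (i + 1) else 0) else 0) =
      ∑ i ∈ Finset.range k, (if j ≤ i then g i - g (i + 1) else 0) :=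
    Finset.sum_congr rfl fun i hi => by rw [if_pos (Finset.mem_range.1 hi)]
  rw [h', h]
  ring

/-- At a prime power the sum telescopes; both sides are multiplicative over coprime factors of n. -/
theorem sum_divisorWeight {f : ℕ → ℝ} (h1 : f 1 = 1)
    (hf : ∀ a b : ℕ, a.Coprime b → f (a * b) = f a * f b) {n d : ℕ} (hn : n ≠ 0) (hd : d ∣ n) :
    ∑ m ∈ n.divisors, (if d ∣ m then divisorWeight f n m else 0) = f d := by
  induction n using Nat.recOnPosPrimePosCoprime generalizing d with
  | zero => exact absurd rfl hn
  | one =>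
    obtain rfl := Nat.dvd_one.1 hd
    simp [divisorWeight, h1]
  | prime_pow p k hp hk =>
    obtain ⟨j, hj, rfl⟩ := (Nat.dvd_prime_pow hp).1 hd
    rw [Nat.sum_divisors_prime_pow hp, ← sum_ite_sub_succ (fun i => f (p ^ i)) hj]
    refine Finset.sum_congr rfl fun i _ => ?_
    rw [divisorWeight_prime_pow f hp hk.ne']
    simp [Nat.pow_dvd_pow_iff_le_right hp.one_lt]
  | coprime a b ha hb hab iha ihb =>
    obtain ⟨x, y, hx, hy, rfl⟩ := (Nat.dvd_mul).1 hd
    have hxy : x.Coprime y := (hab.coprime_dvd_left hx).coprime_dvd_right hy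
    rw [hf x y hxy, ← iha (by omega) hx, ← ihb (by omega) hy,
      sum_divisors_mul_of_coprime hab, Finset.sum_mul_sum]
    refine Finset.sum_congr rfl fun x' hx' => Finset.sum_congr rfl fun y' hy' => ?_
    have hx' := Nat.dvd_of_mem_divisors hx'
    have hy' := Nat.dvd_of_mem_divisors hy'
    rw [divisorWeight_mul f hab (by omega) (by omega) hx' hy']
    have h2 : x * y ∣ x' * y' ↔ x ∣ x' ∧ y ∣ y' := by
      refine ⟨fun h => ⟨?_, ?_⟩, fun h => mul_dvd_mul h.1 h.2⟩
      · exact ((hab.coprime_dvd_left hx).coprime_dvd_right hy').dvd_of_dvd_mul_right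
          ((dvd_mul_right x y).trans h)
      · exact ((hab.coprime_dvd_left hx').coprime_dvd_right hy).symm.dvd_of_dvd_mul_left
          ((dvd_mul_left y x).trans h)
    simp only [h2, ite_and, mul_ite, ite_mul, zero_mul, mul_zero]
    split_ifs <;> rfl

theorem sum_orderOf_eq_sum_divisorWeight {f : ℕ → ℝ} (h1 : f 1 = 1)
    (hf : ∀ a b : ℕ, a.Coprime b → f (a * b) = f a * f b) {n : ℕ} (hn : n ≠ 0)
    (H : Type*) [Group H] [Fintype H] :
    ∑ x : H with orderOf x ∣ n, f (orderOf x) =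
      ∑ m ∈ n.divisors, divisorWeight f n m * powOneCount H m := by
  classical
  have h2 : ∀ x ∈ Finset.univ.filter (fun x : H => orderOf x ∣ n), f (orderOf x) =
      ∑ m ∈ n.divisors, (if orderOf x ∣ m then divisorWeight f n m else 0) :=
    fun x hx => (sum_divisorWeight h1 hf hn (Finset.mem_filter.1 hx).2).symm
  rw [Finset.sum_congr rfl h2, Finset.sum_comm]
  refine Finset.sum_congr rfl fun m hm => ?_
  rw [← Finset.sum_filter, Finset.sum_const, Finset.filter_filter, powOneCount_eq_card_filter,
    nsmul_eq_mul, mul_comm]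
  congr 3
  ext x
  simp only [Finset.mem_filter, Finset.mem_univ, true_and]
  exact and_iff_right_of_imp fun h => h.trans (Nat.dvd_of_mem_divisors hm)

/-! ### The formula for T in terms of solution counts -/

/-- The summand of `RSum` as a function of the element order. -/
noncomputable def orderTerm (r s : ℝ) (d : ℕ) : ℝ := (d : ℝ) ^ s / (Nat.totient d : ℝ) ^ r

theorem orderTerm_one (r s : ℝ) : orderTerm r s 1 = 1 := by simp [orderTerm]

theorem orderTerm_mul (r s : ℝ) (a b : ℕ) (hab : a.Coprime b) :
    orderTerm r s (a * b) = orderTerm r s a * orderTerm r s b := by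
  rw [orderTerm, orderTerm, orderTerm, Nat.totient_mul hab, Nat.cast_mul, Nat.cast_mul,
    Real.mul_rpow (by positivity) (by positivity), Real.mul_rpow (by positivity) (by positivity),
    mul_div_mul_comm]

theorem orderTerm_pos (r s : ℝ) {d : ℕ} (hd : 0 < d) : 0 < orderTerm r s d := by
  have := Nat.totient_pos.2 hd
  unfold orderTerm
  positivity

/-- Since φ(p^(k+1)) = p^k(p-1), the values are geometric with ratio p^(s-r) from exponent 1 on;
only the step from 1 to p behaves differently. -/
theorem orderTerm_prime_pow (r s : ℝ) {p : ℕ} (hp : p.Prime) (k : ℕ) :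
    orderTerm r s (p ^ (k + 1)) = (p : ℝ) ^ s / ((p : ℝ) - 1) ^ r * ((p : ℝ) ^ (s - r)) ^ k := by
  have hp0 : (0 : ℝ) < p := by exact_mod_cast hp.pos
  have hp1 : (0 : ℝ) < (p : ℝ) - 1 := by
    have : (1 : ℝ) < p := by exact_mod_cast hp.one_lt
    linarith
  rw [orderTerm, Nat.totient_prime_pow_succ hp, Nat.cast_mul, Nat.cast_pow, Nat.cast_pow,
    Nat.cast_sub hp.one_le, Nat.cast_one, Real.mul_rpow (by positivity) hp1.le, pow_succ,
    Real.mul_rpow (by positivity) hp0.le, Real.rpow_sub hp0, div_pow, ← Real.rpow_natCast,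
    ← Real.rpow_natCast, ← Real.rpow_natCast, ← Real.rpow_mul hp0.le, ← Real.rpow_mul hp0.le,
    ← Real.rpow_mul hp0.le, ← Real.rpow_mul hp0.le, mul_comm s, mul_comm r]
  have := Real.rpow_pos_of_pos hp0 (k * r)
  have := Real.rpow_pos_of_pos hp1 r
  field_simp

theorem orderTerm_prime_pow_succ (r s : ℝ) {p : ℕ} (hp : p.Prime) (k : ℕ) :
    orderTerm r s (p ^ (k + 2)) = orderTerm r s (p ^ (k + 1)) * (p : ℝ) ^ (s - r) := by
  rw [orderTerm_prime_pow r s hp, orderTerm_prime_pow r s hp, pow_succ, mul_assoc]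

theorem RSum_eq_sum_divisorWeight (H : Type*) [Group H] [Fintype H] {n : ℕ} (hn : n ≠ 0) (r s : ℝ) :
    RSum H n r s = ∑ m ∈ n.divisors, divisorWeight (orderTerm r s) n m * powOneCount H m :=
  sum_orderOf_eq_sum_divisorWeight (orderTerm_one r s) (orderTerm_mul r s) hn H

theorem card_cyclicModel (G : Type*) [Fintype G] : Nat.card (CyclicModel G) = Fintype.card G :=
  (Nat.card_congr Multiplicative.toAdd).trans (Nat.card_zmod _)

theorem RSum_cyclicModel (G : Type*) [Group G] [Fintype G] {n : ℕ} (hn : n ∣ Fintype.card G) (r s : ℝ) :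
    RSum (CyclicModel G) n r s = ∑ m ∈ n.divisors, divisorWeight (orderTerm r s) n m * m := by
  rw [RSum_eq_sum_divisorWeight _ (ne_zero_of_dvd_ne_zero Fintype.card_ne_zero hn)]
  refine Finset.sum_congr rfl fun m hm => ?_
  have : IsCyclic (CyclicModel G) := inferInstanceAs (IsCyclic (Multiplicative (ZMod _)))
  rw [powOneCount_of_isCyclic (G := CyclicModel G)]
  rw [card_cyclicModel]
  exact (Nat.dvd_of_mem_divisors hm).trans hn

theorem TDiff_eq_sum_divisorWeight (G : Type*) [Group G] [Fintype G] {n : ℕ}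
    (hn : n ∣ Fintype.card G) (r s : ℝ) :
    TDiff G n r s =
      ∑ m ∈ n.divisors, divisorWeight (orderTerm r s) n m * ((powOneCount G m : ℝ) - m) := by
  have hn0 := ne_zero_of_dvd_ne_zero Fintype.card_ne_zero hn
  rw [TDiff, RSum_eq_sum_divisorWeight G hn0, RSum_cyclicModel G hn, ← Finset.sum_sub_distrib]
  exact Finset.sum_congr rfl fun m _ => (mul_sub _ _ _).symm

/-- Frobenius makes every term nonnegative, so the sum vanishes only termwise. -/
theorem TDiff_nonneg_and_eq_zero_iff (G : Type*) [Group G] [Fintype G] {n : ℕ}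
    (hn : n ∣ Fintype.card G) {r s : ℝ}
    (hw : ∀ m, m ∣ n → 0 ≤ divisorWeight (orderTerm r s) n m) :
    0 ≤ TDiff G n r s ∧ (TDiff G n r s = 0 ↔
      ∀ m, m ∣ n → divisorWeight (orderTerm r s) n m ≠ 0 → powOneCount G m = m) := by
  have hn0 := ne_zero_of_dvd_ne_zero Fintype.card_ne_zero hn
  have h : ∀ m ∈ n.divisors,
      0 ≤ divisorWeight (orderTerm r s) n m * ((powOneCount G m : ℝ) - m) := fun m hm => by
    have hm := Nat.dvd_of_mem_divisors hm
    refine mul_nonneg (hw m hm) (sub_nonneg.2 ?_)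
    exact_mod_cast le_powOneCount (by rw [Nat.card_eq_fintype_card]; exact hm.trans hn)
  rw [TDiff_eq_sum_divisorWeight G hn]
  refine ⟨Finset.sum_nonneg h, ?_⟩
  rw [Finset.sum_eq_zero_iff_of_nonneg h]
  refine forall_congr' fun m => ?_
  rw [Nat.mem_divisors, and_iff_left hn0, mul_eq_zero, sub_eq_zero, Nat.cast_inj, or_iff_not_imp_left]

/-! ### The case s < r, s ≤ 0 -/

theorem divisorWeight_nonneg {f : ℕ → ℝ} {n m : ℕ} (hf : ∀ p k, p.Prime → 0 ≤ f (p ^ k))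
    (h : ∀ p k, p.Prime → f (p ^ (k + 1)) ≤ f (p ^ k)) : 0 ≤ divisorWeight f n m := by
  refine Finset.prod_nonneg fun p hp => ?_
  have hp := Nat.prime_of_mem_primeFactors hp
  split_ifs
  · exact sub_nonneg.2 (h p _ hp)
  · simpa using hf p _ hp

theorem divisorWeight_pos {f : ℕ → ℝ} {n m : ℕ} (hf : ∀ p k, p.Prime → 0 < f (p ^ k))
    (h : ∀ p ∈ n.primeFactors, m.factorization p < n.factorization p →
      f (p ^ (m.factorization p + 1)) < f (p ^ m.factorization p)) : 0 < divisorWeight f n m := by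
  refine Finset.prod_pos fun p hp => ?_
  split_ifs with h1
  · exact sub_pos.2 (h p hp h1)
  · simpa using hf p _ (Nat.prime_of_mem_primeFactors hp)

theorem orderTerm_prime_pow_pos (r s : ℝ) (p k : ℕ) (hp : p.Prime) : 0 < orderTerm r s (p ^ k) :=
  orderTerm_pos r s (pow_pos hp.pos k)

theorem orderTerm_prime (r s : ℝ) {p : ℕ} (hp : p.Prime) :
    orderTerm r s p = (p : ℝ) ^ s / ((p : ℝ) - 1) ^ r := by
  simpa using orderTerm_prime_pow r s hp 0

/-- The prime 2 is exceptional because φ(2) = 1: the value there is 2^s, which equals 1 when s = 0.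
-/
theorem orderTerm_prime_le_one {r s : ℝ} (hsr : s < r) (hs : s ≤ 0) {p : ℕ} (hp : p.Prime) :
    orderTerm r s p ≤ 1 ∧ (p ≠ 2 → orderTerm r s p < 1) := by
  have hp1 : (1 : ℝ) < p := by exact_mod_cast hp.one_lt
  have hq2 : (1 : ℝ) ≤ (p : ℝ) - 1 := by
    have : (2 : ℝ) ≤ p := by exact_mod_cast hp.two_le
    linarith
  have hq : (0 : ℝ) < (p : ℝ) - 1 := by linarith
  have hpos := Real.rpow_pos_of_pos hq r
  have hps : (p : ℝ) ^ s ≤ 1 := Real.rpow_le_one_of_one_le_of_nonpos hp1.le hs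
  rw [orderTerm_prime r s hp, div_le_one hpos, div_lt_one hpos]
  rcases lt_or_ge r 0 with hr | hr
  · have h : (p : ℝ) ^ s < ((p : ℝ) - 1) ^ r :=
      (Real.rpow_lt_rpow_of_exponent_lt hp1 hsr).trans
        (Real.rpow_lt_rpow_of_neg hq (by linarith) hr)
    exact ⟨h.le, fun _ => h⟩
  · have hone : 1 ≤ ((p : ℝ) - 1) ^ r := Real.one_le_rpow hq2 hr
    refine ⟨hps.trans hone, fun hp2 => ?_⟩
    rcases hr.eq_or_lt with rfl | hr
    · exact (Real.rpow_lt_one_of_one_lt_of_neg hp1 hsr).trans_le hone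
    · refine hps.trans_lt (Real.one_lt_rpow ?_ hr)
      have : (3 : ℝ) ≤ p := by exact_mod_cast lt_of_le_of_ne hp.two_le hp2.symm
      linarith

theorem orderTerm_prime_pow_succ_lt {r s : ℝ} (hsr : s < r) {p : ℕ} (hp : p.Prime) (k : ℕ) :
    orderTerm r s (p ^ (k + 2)) < orderTerm r s (p ^ (k + 1)) := by
  rw [orderTerm_prime_pow_succ r s hp]
  refine mul_lt_of_lt_one_right (orderTerm_prime_pow_pos r s p _ hp) ?_
  exact Real.rpow_lt_one_of_one_lt_of_neg (by exact_mod_cast hp.one_lt) (by linarith)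

/-- The unique involution t is central, so x ↦ x and x ↦ tx embed two disjoint copies of the
solutions of x^m = 1 into those of x^(2m) = 1. -/
theorem powOneCount_le_of_odd {G : Type*} [Group G] [Finite G] {m : ℕ} (hm : Odd m)
    (h2 : powOneCount G 2 = 2) (h2m : powOneCount G (2 * m) = 2 * m) : powOneCount G m ≤ m := by
  have hex : ∃ t : G, t ^ 2 = 1 ∧ t ≠ 1 ∧ ∀ x : G, x ^ 2 = 1 → x = 1 ∨ x = t := by
    obtain ⟨t, ht, h⟩ := (Nat.card_eq_two_iff' (⟨1, one_pow 2⟩ : {x : G // x ^ 2 = 1})).1 h2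
    refine ⟨t, t.2, fun h1 => ht (Subtype.ext h1), fun x hx => or_iff_not_imp_left.2 fun hx1 => ?_⟩
    exact congrArg Subtype.val (h ⟨x, hx⟩ fun h1 => hx1 (congrArg Subtype.val h1))
  obtain ⟨t, ht, ht1, hex⟩ := hex
  have htc : ∀ g : G, Commute t g := by
    intro g
    have h3 : (g * t * g⁻¹) ^ 2 = 1 := by rw [conj_pow, ht]; simp
    rcases hex _ h3 with h | h
    · exact absurd (by simpa using h) ht1
    · rw [commute_iff_eq, ← mul_inv_eq_iff_eq_mul.1 h]
  have htm : t ^ m = t := by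
    obtain ⟨c, rfl⟩ := hm
    rw [pow_succ, pow_mul, ht, one_pow, one_mul]
  have hinj : Nat.card ({x : G // x ^ m = 1} × Bool) ≤ Nat.card {x : G // x ^ (2 * m) = 1} := by
    refine Nat.card_le_card_of_injective
      (fun q => ⟨bif q.2 then t * q.1.1 else q.1.1, ?_⟩) ?_
    · obtain ⟨⟨x, hx⟩, b⟩ := q
      cases b
      · simp [mul_comm 2 m, pow_mul, hx]
      · simp [(htc x).mul_pow, pow_mul, mul_comm 2 m, hx]
        rw [← pow_mul, mul_comm, pow_mul, ht, one_pow]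
    · have hne : ∀ x y : G, x ^ m = 1 → y ^ m = 1 → t * x ≠ y := by
        intro x y hx hy h
        apply ht1
        have := congrArg (· ^ m) h
        simpa [(htc x).mul_pow, htm, hx, hy] using this
      rintro ⟨⟨x, hx⟩, b⟩ ⟨⟨y, hy⟩, c⟩ h
      cases b <;> cases c <;> simp at h
      · simp [h]
      · exact absurd h.symm (hne y x hy hx)
      · exact absurd h (hne x y hx hy)
      · simp [h]
  rw [Nat.card_prod] at hinj
  change powOneCount G m * Nat.card Bool ≤ powOneCount G (2 * m) at hinj
  simp at hinj
  omega

/-- With c(d) cyclic subgroups of order d, N(m) = ∑_{d∣m} φ(d)c(d), while m = ∑_{d∣m} φ(d). Compare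
them by induction on m. -/
theorem powOneCount_eq_self_iff (G : Type*) [Group G] [Finite G] {n : ℕ} (hn : n ≠ 0) :
    (∀ m, m ∣ n → powOneCount G m = m) ↔
      ∀ m, m ∣ n → ∃! H : Subgroup G, IsCyclic H ∧ Nat.card H = m := by
  classical
  have := Fintype.ofFinite G
  have h1 : ∀ m, (∃! H : Subgroup G, IsCyclic H ∧ Nat.card H = m) ↔
      Nat.card {H : Subgroup G // IsCyclic H ∧ Nat.card H = m} = 1 := by
    intro m
    rw [Nat.card_eq_one_iff_unique, ← unique_subtype_iff_existsUnique,
      unique_iff_subsingleton_and_nonempty]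
  have h2 : ∀ m, m ≠ 0 → powOneCount G m = ∑ d ∈ m.divisors,
      d.totient * Nat.card {H : Subgroup G // IsCyclic H ∧ Nat.card H = d} := fun m hm => by
    rw [powOneCount_eq_sum G hm]
    exact Finset.sum_congr rfl fun d _ => card_filter_orderOf_eq G
  simp_rw [h1]
  constructor
  · intro h m
    induction m using Nat.strong_induction_on with
    | _ m ih =>
    intro hm
    have hm0 := ne_zero_of_dvd_ne_zero hn hm
    have h3 := h2 m hm0
    rw [h m hm] at h3
    nth_rw 1 [← Nat.sum_totient m] at h3
    rw [← Nat.cons_self_properDivisors hm0, Finset.sum_cons, Finset.sum_cons] at h3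
    have h4 : ∑ d ∈ m.properDivisors, d.totient * Nat.card {H : Subgroup G // IsCyclic H ∧ Nat.card H = d} =
        ∑ d ∈ m.properDivisors, d.totient := Finset.sum_congr rfl fun d hd => by
      have hd := Nat.mem_properDivisors.1 hd
      rw [ih d hd.2 (hd.1.trans hm), mul_one]
    rw [h4] at h3
    have h5 := Nat.add_right_cancel h3
    have := Nat.totient_pos.2 (Nat.pos_of_ne_zero hm0)
    nlinarith
  · intro h m hm
    rw [h2 m (ne_zero_of_dvd_ne_zero hn hm)]
    conv_rhs => rw [← Nat.sum_totient m]
    refine Finset.sum_congr rfl fun d hd => ?_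
    rw [h d ((Nat.dvd_of_mem_divisors hd).trans hm), mul_one]

theorem TDiff_of_lt_of_nonpos (G : Type*) [Group G] [Fintype G] {n : ℕ}
    (hn : n ∣ Fintype.card G) {r s : ℝ} (hsr : s < r) (hs : s ≤ 0) :
    0 ≤ TDiff G n r s ∧ (TDiff G n r s = 0 ↔
      ∀ m : ℕ, m ∣ n → ∃! H : Subgroup G, IsCyclic H ∧ Nat.card H = m) := by
  have hn0 := ne_zero_of_dvd_ne_zero Fintype.card_ne_zero hn
  have hle : ∀ p k, p.Prime → orderTerm r s (p ^ (k + 1)) ≤ orderTerm r s (p ^ k) := by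
    rintro p (_ | k) hp
    · simpa [orderTerm_one] using (orderTerm_prime_le_one hsr hs hp).1
    · exact (orderTerm_prime_pow_succ_lt hsr hp k).le
  obtain ⟨h0, h1⟩ := TDiff_nonneg_and_eq_zero_iff G hn (r := r) (s := s) fun m _ =>
    divisorWeight_nonneg (fun p k hp => (orderTerm_prime_pow_pos r s p k hp).le) hle
  refine ⟨h0, ?_⟩
  rw [h1, ← powOneCount_eq_self_iff G hn0]
  refine ⟨fun h => ?_, fun h m hm _ => h m hm⟩
  -- The weight is strictly positive here: the only step of f that may fail to be strict, from 1 to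
  -- 2, does not occur.
  have hpos : ∀ m, m ∣ n → (2 ∣ n → 2 ∣ m) → powOneCount G m = m := by
    intro m hm h2
    refine h m hm (divisorWeight_pos (orderTerm_prime_pow_pos r s) fun p hp hlt => ?_).ne'
    have hpp := Nat.prime_of_mem_primeFactors hp
    rcases hk : m.factorization p with _ | k
    · have hp2 : p ≠ 2 := by
        rintro rfl
        have := (hpp.dvd_iff_one_le_factorization (ne_zero_of_dvd_ne_zero hn0 hm)).1
          (h2 (Nat.dvd_of_mem_primeFactors hp))
        omega
      simpa [orderTerm_one] using (orderTerm_prime_le_one hsr hs hpp).2 hp2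
    · exact orderTerm_prime_pow_succ_lt hsr hpp k
  intro m hm
  by_cases h2 : 2 ∣ n → 2 ∣ m
  · exact hpos m hm h2
  · push Not at h2
    -- The weight of an odd m may vanish when n is even; the counts at 2 and 2m, both already known,
    -- determine N(m).
    have hodd : Odd m := Nat.not_even_iff_odd.1 fun h => h2.2 h.two_dvd
    have h2m : 2 * m ∣ n := Nat.Coprime.mul_dvd_of_dvd_of_dvd
      ((Nat.Prime.coprime_iff_not_dvd Nat.prime_two).2 h2.2) h2.1 hm
    refine le_antisymm ?_ (le_powOneCount (by rw [Nat.card_eq_fintype_card]; exact hm.trans hn))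
    exact powOneCount_le_of_odd hodd (hpos 2 h2.1 fun _ => dvd_rfl)
      (hpos _ h2m fun _ => dvd_mul_right _ _)

/-! ### Nilpotent groups -/

/-- Pass to the product of the Sylow subgroups: in each coordinate the two orders are coprime powers
of one prime, so one of the entries is trivial. -/
theorem commute_of_coprime_of_isNilpotent {G : Type*} [Group G] [Finite G] [Group.IsNilpotent G]
    {x y : G} (h : (orderOf x).Coprime (orderOf y)) : Commute x y := by
  obtain ⟨e⟩ := ((Group.isNilpotent_of_finite_tfae (G := G)).out 0 4 rfl rfl).1 ‹_›
  suffices Commute (e.symm x) (e.symm y) by simpa using this.map e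
  rw [← e.symm.orderOf_eq x, ← e.symm.orderOf_eq y] at h
  generalize e.symm x = x' at h ⊢
  generalize e.symm y = y' at h ⊢
  have hx : ∀ p P, orderOf (x' p P) ∣ orderOf x' := fun p P =>
    orderOf_dvd_of_pow_eq_one (by rw [← Pi.pow_apply, ← Pi.pow_apply, pow_orderOf_eq_one]; rfl)
  have hy : ∀ p P, orderOf (y' p P) ∣ orderOf y' := fun p P =>
    orderOf_dvd_of_pow_eq_one (by rw [← Pi.pow_apply, ← Pi.pow_apply, pow_orderOf_eq_one]; rfl)
  refine funext fun p => funext fun P => ?_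
  have hp : (p : ℕ).Prime := Nat.prime_of_mem_primeFactors p.2
  have := Fact.mk hp
  change x' p P * y' p P = y' p P * x' p P
  have hco : (orderOf (x' p P)).Coprime (orderOf (y' p P)) :=
    (h.coprime_dvd_left (hx p P)).coprime_dvd_right (hy p P)
  obtain ⟨i, hi⟩ := (IsPGroup.iff_orderOf.1 P.2) (x' p P)
  obtain ⟨j, hj⟩ := (IsPGroup.iff_orderOf.1 P.2) (y' p P)
  rcases i with _ | i
  · have h1 : x' p P = 1 := orderOf_eq_one_iff.1 (by simpa using hi)
    rw [h1, one_mul, mul_one]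
  rcases j with _ | j
  · have h1 : y' p P = 1 := orderOf_eq_one_iff.1 (by simpa using hj)
    rw [h1, one_mul, mul_one]
  rw [hi, hj] at hco
  exact absurd (Nat.eq_one_of_dvd_coprimes hco (dvd_pow_self _ i.succ_ne_zero)
    (dvd_pow_self _ j.succ_ne_zero)) hp.one_lt.ne'

theorem sum_orderOf_mul_of_isNilpotent {G : Type*} [Group G] [Fintype G] [Group.IsNilpotent G]
    {f : ℕ → ℝ} (hf : ∀ a b : ℕ, a.Coprime b → f (a * b) = f a * f b) {a b : ℕ} (hab : a.Coprime b) :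
    ∑ x : G with orderOf x ∣ a * b, f (orderOf x) =
      (∑ x : G with orderOf x ∣ a, f (orderOf x)) * ∑ x : G with orderOf x ∣ b, f (orderOf x) := by
  obtain ⟨e, he⟩ := exists_powOneEquiv hab G
  rw [Finset.sum_mul_sum, ← Finset.sum_product']
  symm
  have hc : ∀ q ∈ (Finset.univ.filter fun x : G => orderOf x ∣ a) ×ˢ
      (Finset.univ.filter fun x : G => orderOf x ∣ b), (orderOf q.1).Coprime (orderOf q.2) := by
    intro q hq
    simp only [Finset.mem_product, Finset.mem_filter, Finset.mem_univ, true_and] at hq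
    exact (hab.coprime_dvd_left hq.1).coprime_dvd_right hq.2
  have hq : ∀ q ∈ (Finset.univ.filter fun x : G => orderOf x ∣ a) ×ˢ
      (Finset.univ.filter fun x : G => orderOf x ∣ b),
      q.1 ^ a = 1 ∧ q.2 ^ b = 1 ∧ Commute q.1 q.2 := by
    intro q hq
    have := commute_of_coprime_of_isNilpotent (hc q hq)
    simp only [Finset.mem_product, Finset.mem_filter, Finset.mem_univ, true_and,
      orderOf_dvd_iff_pow_eq_one] at hq
    exact ⟨hq.1, hq.2, this⟩
  refine Finset.sum_bij (fun q h => (e ⟨q, hq q h⟩ : G)) ?_ ?_ ?_ ?_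
  · intro q h
    simpa [orderOf_dvd_iff_pow_eq_one] using (e ⟨q, hq q h⟩).2
  · intro q h q' h' heq
    exact congrArg Subtype.val (e.injective (Subtype.ext heq))
  · intro x hx
    have hx' : x ^ (a * b) = 1 := by simpa [orderOf_dvd_iff_pow_eq_one] using hx
    have h3 := (e.symm ⟨x, hx'⟩).2
    refine ⟨(e.symm ⟨x, hx'⟩).1, ?_, by simp⟩
    simpa [orderOf_dvd_iff_pow_eq_one] using And.intro h3.1 h3.2.1
  · intro q h
    rw [he, (hq q h).2.2.orderOf_mul_eq_mul_orderOf_of_coprime (hc q h), hf _ _ (hc q h)]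

theorem powOneCount_mul_of_isNilpotent (G : Type*) [Group G] [Finite G] [Group.IsNilpotent G]
    {a b : ℕ} (hab : a.Coprime b) : powOneCount G (a * b) = powOneCount G a * powOneCount G b := by
  classical
  have := Fintype.ofFinite G
  have h := sum_orderOf_mul_of_isNilpotent (G := G) (f := fun _ => 1) (by simp) hab
  simp only [Finset.sum_const, nsmul_eq_mul, mul_one] at h
  simp only [powOneCount_eq_card_filter]
  exact_mod_cast h

/-- Multiplicativity gives N(a)N(b) = ab, and Frobenius gives N(a) ≥ a and N(b) ≥ b. -/
theorem powOneCount_of_isNilpotent (G : Type*) [Group G] [Finite G] [Group.IsNilpotent G]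
    {a b : ℕ} (hab : a.Coprime b) (h : a * b = Nat.card G) : powOneCount G a = a := by
  have h1 := powOneCount_mul_of_isNilpotent G hab
  rw [h, powOneCount_card, ← h] at h1
  have ha := le_powOneCount (G := G) (Dvd.intro _ h)
  have hb := le_powOneCount (G := G) (Dvd.intro_left _ h)
  have hpos : 0 < a * b := h ▸ Nat.card_pos
  refine le_antisymm ?_ ha
  have hb0 : 0 < b := Nat.pos_of_mul_pos_left hpos
  exact Nat.le_of_mul_le_mul_right ((Nat.mul_le_mul_left _ hb).trans h1.ge) hb0

theorem RSum_eq_prod_of_isNilpotent (G : Type*) [Group G] [Fintype G] [Group.IsNilpotent G]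
    {n : ℕ} (hn : n ≠ 0) (r s : ℝ) :
    RSum G n r s = ∏ p ∈ n.primeFactors, RSum G (p ^ n.factorization p) r s := by
  induction n using Nat.recOnPosPrimePosCoprime with
  | zero => exact absurd rfl hn
  | one => simp [RSum_eq_sum_divisorWeight, divisorWeight, powOneCount]
  | prime_pow p k hp hk =>
    rw [Nat.primeFactors_prime_pow hk.ne' hp, Finset.prod_singleton]
    simp [hp.factorization_pow]
  | coprime a b ha hb hab iha ihb =>
    have h : RSum G (a * b) r s = RSum G a r s * RSum G b r s :=
      sum_orderOf_mul_of_isNilpotent (orderTerm_mul r s) hab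
    rw [h, iha (by omega), ihb (by omega), hab.primeFactors_mul,
      Finset.prod_union hab.disjoint_primeFactors]
    congr 1
    · refine Finset.prod_congr rfl fun p hp => ?_
      have h1 : b.factorization p = 0 := Nat.factorization_eq_zero_of_not_dvd fun h =>
        (Nat.prime_of_mem_primeFactors hp).one_lt.ne'
          (Nat.eq_one_of_dvd_coprimes hab (Nat.dvd_of_mem_primeFactors hp) h)
      rw [Nat.factorization_mul (by omega) (by omega), Finsupp.add_apply, h1, add_zero]
    · refine Finset.prod_congr rfl fun p hp => ?_
      have h1 : a.factorization p = 0 := Nat.factorization_eq_zero_of_not_dvd fun h =>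
        (Nat.prime_of_mem_primeFactors hp).one_lt.ne'
          (Nat.eq_one_of_dvd_coprimes hab h (Nat.dvd_of_mem_primeFactors hp))
      rw [Nat.factorization_mul (by omega) (by omega), Finsupp.add_apply, h1, zero_add]

theorem RSum_pos (G : Type*) [Group G] [Fintype G] (n : ℕ) (r s : ℝ) : 0 < RSum G n r s :=
  Finset.sum_pos (fun x _ => orderTerm_pos r s (orderOf_pos x)) ⟨1, by simp⟩

/-- For 1 ≤ i ≤ v the weight of p^i is (1 - p^(s-r))f(p^i). The two end terms drop out because N(1)
= 1 and N(p^(v+1)) = p^(v+1), leaving a sign factor times a nonnegative sum. -/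
theorem TDiff_prime_pow (G : Type*) [Group G] [Fintype G] {p v : ℕ} (hp : p.Prime)
    (hv : p ^ (v + 1) ∣ Fintype.card G) (hN : powOneCount G (p ^ (v + 1)) = p ^ (v + 1)) (r s : ℝ) :
    TDiff G (p ^ (v + 1)) r s = (1 - (p : ℝ) ^ (s - r)) * ∑ i ∈ Finset.range v,
      orderTerm r s (p ^ (i + 1)) * ((powOneCount G (p ^ (i + 1)) : ℝ) - (p ^ (i + 1) : ℕ)) := by
  rw [TDiff_eq_sum_divisorWeight G hv, Nat.sum_divisors_prime_pow hp, Finset.sum_range_succ, hN, sub_self,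
    mul_zero, add_zero, Finset.sum_range_succ', pow_zero]
  have h1 : powOneCount G 1 = 1 := by simp [powOneCount]
  rw [h1, sub_self, mul_zero, add_zero, Finset.mul_sum]
  refine Finset.sum_congr rfl fun i hi => ?_
  have hi := Finset.mem_range.1 hi
  rw [divisorWeight_prime_pow _ hp (by omega), if_pos (by omega), orderTerm_prime_pow_succ r s hp]
  ring

theorem isCyclic_of_powOneCount_prime_pow (G : Type*) [Group G] [Finite G] [Group.IsNilpotent G]
    (h : ∀ p k, p.Prime → p ^ k ∣ Nat.card G → powOneCount G (p ^ k) = p ^ k) : IsCyclic G := by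
  classical
  have := Fintype.ofFinite G
  have h1 : ∀ m, m ∣ Nat.card G → powOneCount G m = m := by
    intro m
    induction m using Nat.recOnPosPrimePosCoprime with
    | zero => intro h0; exact absurd (zero_dvd_iff.1 h0) Nat.card_pos.ne'
    | one => simp [powOneCount]
    | prime_pow p k hp hk => exact h p k hp
    | coprime a b ha hb hab iha ihb =>
      intro hd
      rw [powOneCount_mul_of_isNilpotent G hab, iha ((dvd_mul_right a b).trans hd),
        ihb ((dvd_mul_left b a).trans hd)]
  refine isCyclic_of_card_pow_eq_one_le fun n hn => ?_
  have h2 : (Finset.univ.filter fun x : G => x ^ n = 1).card = powOneCount G n := by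
    rw [powOneCount, Nat.card_eq_fintype_card, Fintype.card_subtype]
  rw [h2, ← powOneCount_gcd, h1 _ (Nat.gcd_dvd_right _ _)]
  exact Nat.gcd_le_left _ hn

theorem sum_prime_pow_nonneg (G : Type*) [Group G] [Fintype G] {p v : ℕ} (hp : p.Prime)
    (hv : p ^ (v + 1) ∣ Fintype.card G) (r s : ℝ) : ∀ i ∈ Finset.range v, 0 ≤
      orderTerm r s (p ^ (i + 1)) * ((powOneCount G (p ^ (i + 1)) : ℝ) - (p ^ (i + 1) : ℕ)) := by
  intro i hi
  have hi := Finset.mem_range.1 hi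
  refine mul_nonneg (orderTerm_prime_pow_pos r s p _ hp).le (sub_nonneg.2 ?_)
  refine Nat.cast_le.2 (le_powOneCount ?_)
  rw [Nat.card_eq_fintype_card]
  exact (pow_dvd_pow p (by omega)).trans hv

/-- For a nilpotent group, the comparison with the cyclic group splits into the primary parts. -/
theorem exists_primary_comparison (G : Type*) [Group G] [Fintype G] [Group.IsNilpotent G] (r s : ℝ) :
    ∃ D : ℕ → ℝ, (∀ p ∈ (Fintype.card G).primeFactors, 0 ≤ D p ∧
      RSum G (p ^ (Fintype.card G).factorization p) r s =
        RSum (CyclicModel G) (p ^ (Fintype.card G).factorization p) r s + (1 - (p : ℝ) ^ (s - r)) * D p) ∧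
      (¬ IsCyclic G → ∃ p ∈ (Fintype.card G).primeFactors, 0 < D p) := by
  have hcard : Nat.card G = Fintype.card G := Nat.card_eq_fintype_card
  have hfac : ∀ p ∈ (Fintype.card G).primeFactors, ∃ v, (Fintype.card G).factorization p = v + 1 := by
    intro p hp
    refine ⟨(Fintype.card G).factorization p - 1, ?_⟩
    have := (Nat.prime_of_mem_primeFactors hp).factorization_pos_of_dvd Fintype.card_ne_zero
      (Nat.dvd_of_mem_primeFactors hp)
    omega
  -- The sum from `TDiff_prime_pow`; the exponent of p is positive, so subtracting 1 does not
  -- truncate.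
  refine ⟨fun p => ∑ i ∈ Finset.range ((Fintype.card G).factorization p - 1),
    orderTerm r s (p ^ (i + 1)) * ((powOneCount G (p ^ (i + 1)) : ℝ) - (p ^ (i + 1) : ℕ)), ?_, ?_⟩
  · intro p hp
    have hpp := Nat.prime_of_mem_primeFactors hp
    have hd := Nat.ordProj_dvd (Fintype.card G) p
    have hN : powOneCount G (p ^ (Fintype.card G).factorization p) =
        p ^ (Fintype.card G).factorization p :=
      powOneCount_of_isNilpotent G ((Nat.coprime_ordCompl hpp Fintype.card_ne_zero).pow_left _)
        (by rw [Nat.ordProj_mul_ordCompl_eq_self, hcard])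
    obtain ⟨v, hv⟩ := hfac p hp
    rw [hv] at hd hN
    simp only [hv, Nat.add_sub_cancel]
    refine ⟨Finset.sum_nonneg (sum_prime_pow_nonneg G hpp hd r s), ?_⟩
    rw [← TDiff_prime_pow G hpp hd hN, TDiff]
    ring
  · intro hG
    -- If no D p is positive, all excesses N(p^i) - p^i vanish, which makes G cyclic.
    by_contra hcon
    push Not at hcon
    refine hG (isCyclic_of_powOneCount_prime_pow G fun p k hp hk => ?_)
    rcases k with _ | k
    · simp [powOneCount]
    have hpm : p ∈ (Fintype.card G).primeFactors :=
      Nat.mem_primeFactors.2 ⟨hp, (dvd_pow_self p k.succ_ne_zero).trans (hcard ▸ hk), Fintype.card_ne_zero⟩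
    obtain ⟨v, hv⟩ := hfac p hpm
    have hd := Nat.ordProj_dvd (Fintype.card G) p
    have hkv : k + 1 ≤ v + 1 := by
      rw [← hv]
      exact (hp.pow_dvd_iff_le_factorization Fintype.card_ne_zero).1 (hcard ▸ hk)
    rcases hkv.eq_or_lt with hkv | hkv
    · rw [hkv, ← hv]
      exact powOneCount_of_isNilpotent G ((Nat.coprime_ordCompl hp Fintype.card_ne_zero).pow_left _)
        (by rw [Nat.ordProj_mul_ordCompl_eq_self, hcard])
    · have h0 := hcon p hpm
      rw [hv] at hd
      simp only [hv, Nat.add_sub_cancel] at h0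
      have hnn := sum_prime_pow_nonneg G hp hd r s
      have h1 := (Finset.sum_eq_zero_iff_of_nonneg hnn).1 (le_antisymm h0 (Finset.sum_nonneg hnn)) k
        (Finset.mem_range.2 (by omega))
      rcases mul_eq_zero.1 h1 with h2 | h2
      · exact absurd h2 (orderTerm_prime_pow_pos r s p _ hp).ne'
      · exact_mod_cast sub_eq_zero.1 h2

theorem TDiffTotal_eq_prod_sub_prod (G : Type*) [Group G] [Fintype G] [Group.IsNilpotent G] (r s : ℝ) :
    TDiffTotal G r s =
      ∏ p ∈ (Fintype.card G).primeFactors, RSum G (p ^ (Fintype.card G).factorization p) r s -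
      ∏ p ∈ (Fintype.card G).primeFactors,
        RSum (CyclicModel G) (p ^ (Fintype.card G).factorization p) r s := by
  rw [TDiffTotal, TDiff, RSum_eq_prod_of_isNilpotent G Fintype.card_ne_zero,
    RSum_eq_prod_of_isNilpotent (CyclicModel G) Fintype.card_ne_zero]

theorem TDiffTotal_self_of_isNilpotent (G : Type*) [Group G] [Fintype G] [Group.IsNilpotent G] (r : ℝ) :
    TDiffTotal G r r = 0 := by
  obtain ⟨D, hD, -⟩ := exists_primary_comparison G r r
  rw [TDiffTotal_eq_prod_sub_prod, sub_eq_zero]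
  refine Finset.prod_congr rfl fun p hp => ?_
  rw [(hD p hp).2]
  simp

theorem sign_TDiffTotal_of_isNilpotent (G : Type*) [Group G] [Fintype G] [Group.IsNilpotent G]
    (hG : ¬ IsCyclic G) (r s : ℝ) : SignType.sign (TDiffTotal G r s) = SignType.sign (r - s) := by
  obtain ⟨D, hD, hDp⟩ := exists_primary_comparison G r s
  obtain ⟨q, hq, hDq⟩ := hDp hG
  have hlt : ∀ p ∈ (Fintype.card G).primeFactors, (1 : ℝ) < p := fun p hp => by
    exact_mod_cast (Nat.prime_of_mem_primeFactors hp).one_lt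
  rcases lt_trichotomy s r with h | rfl | h
  · have hc : ∀ p ∈ (Fintype.card G).primeFactors, 0 < 1 - (p : ℝ) ^ (s - r) := fun p hp =>
      sub_pos.2 (Real.rpow_lt_one_of_one_lt_of_neg (hlt p hp) (by linarith))
    rw [sign_pos (sub_pos.2 h), sign_pos]
    rw [TDiffTotal_eq_prod_sub_prod, sub_pos]
    -- All factors are positive and compare in the same direction, strictly at q.
    refine Finset.prod_lt_prod (fun _ _ => RSum_pos _ _ _ _) (fun p hp => ?_) ⟨q, hq, ?_⟩
    · rw [(hD p hp).2]
      exact le_add_of_nonneg_right (mul_nonneg (hc p hp).le (hD p hp).1)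
    · rw [(hD q hq).2]
      exact lt_add_of_pos_right _ (mul_pos (hc q hq) hDq)
  · rw [TDiffTotal_self_of_isNilpotent, sub_self]
  · have hc : ∀ p ∈ (Fintype.card G).primeFactors, 1 - (p : ℝ) ^ (s - r) < 0 := fun p hp =>
      sub_neg.2 (Real.one_lt_rpow (hlt p hp) (by linarith))
    rw [sign_neg (sub_neg.2 h), sign_neg]
    rw [TDiffTotal_eq_prod_sub_prod, sub_neg]
    refine Finset.prod_lt_prod (fun _ _ => RSum_pos _ _ _ _) (fun p hp => ?_) ⟨q, hq, ?_⟩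
    · rw [(hD p hp).2]
      exact add_le_of_nonpos_right (mul_nonpos_of_nonpos_of_nonneg (hc p hp).le (hD p hp).1)
    · rw [(hD q hq).2]
      exact add_lt_of_neg_right _ (mul_neg_of_neg_of_pos (hc q hq) hDq)

/-! ### The case s = r < 0 -/

theorem normal_of_mem_iff_pow_eq_one {G : Type*} [Group G] {A : Subgroup G} {m : ℕ}
    (h : ∀ x, x ∈ A ↔ x ^ m = 1) : A.Normal :=
  ⟨fun x hx g => by rw [h] at hx ⊢; rw [conj_pow, hx]; simp⟩

theorem card_of_mem_iff_pow_eq_one {G : Type*} [Group G] {A : Subgroup G} {m : ℕ}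
    (h : ∀ x, x ∈ A ↔ x ^ m = 1) : Nat.card A = powOneCount G m :=
  Nat.card_congr (Equiv.subtypeEquivRight h)

/-- A subgroup of order `m` in a group with `m` solutions of `x ^ m = 1` consists of these solutions. -/
theorem mem_iff_pow_eq_one_of_card {G : Type*} [Group G] [Finite G] {A : Subgroup G} {m : ℕ}
    (hA : Nat.card A = m) (hm : powOneCount G m = m) (x : G) : x ∈ A ↔ x ^ m = 1 := by
  have hsub : ∀ x ∈ A, x ^ m = 1 := fun x hx =>
    orderOf_dvd_iff_pow_eq_one.1 (hA ▸ Subgroup.orderOf_dvd_natCard A hx)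
  have h : (A : Set G) = {x | x ^ m = 1} := by
    refine Set.eq_of_subset_of_ncard_le hsub ?_ (Set.toFinite _)
    have h1 : ({x | x ^ m = 1} : Set G).ncard = powOneCount G m := rfl
    have h2 : (A : Set G).ncard = Nat.card A := rfl
    rw [h1, h2, hm, hA]
  exact Set.ext_iff.1 h x

/-- If `x ^ a = 1` has exactly `a` solutions for all unitary divisors `a` of `n`, these solutions form
nilpotent subgroups. -/
theorem exists_isNilpotent_of_powOneCount {G : Type*} [Group G] [Finite G] {n : ℕ}
    (hn : n ∣ Nat.card G) (h : ∀ a b, a.Coprime b → a * b = n → powOneCount G a = a) {m k : ℕ}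
    (hmk : m.Coprime k) (hn' : m * k = n) :
    ∃ A : Subgroup G, Group.IsNilpotent A ∧ ∀ x, x ∈ A ↔ x ^ m = 1 := by
  have hn0 : n ≠ 0 := ne_zero_of_dvd_ne_zero Nat.card_pos.ne' hn
  induction m using Nat.recOnPosPrimePosCoprime generalizing k with
  | zero => exact absurd (by rw [← hn', zero_mul]) hn0
  | one => exact ⟨⊥, inferInstance, fun x => by simp⟩
  | prime_pow p v hp hv =>
    have := Fact.mk hp
    obtain ⟨A, hA⟩ := Sylow.exists_subgroup_card_pow_prime (G := G) p
      ((Dvd.intro k hn').trans hn)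
    exact ⟨A, (IsPGroup.of_card hA).isNilpotent, mem_iff_pow_eq_one_of_card hA (h _ _ hmk hn')⟩
  | coprime a b _ _ hab iha ihb =>
    have hak : a.Coprime k := hmk.coprime_dvd_left (dvd_mul_right a b)
    have hbk : b.Coprime k := hmk.coprime_dvd_left (dvd_mul_left b a)
    have hco1 : a.Coprime (b * k) := hab.mul_right hak
    have hco2 : b.Coprime (a * k) := hab.symm.mul_right hbk
    have hn1 : a * (b * k) = n := by rw [← hn']; ring
    have hn2 : b * (a * k) = n := by rw [← hn']; ring
    obtain ⟨A, hAn, hA⟩ := iha hco1 hn1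
    obtain ⟨B, hBn, hB⟩ := ihb hco2 hn2
    have hcA : Nat.card A = a := (card_of_mem_iff_pow_eq_one hA).trans (h _ _ hco1 hn1)
    have hcB : Nat.card B = b := (card_of_mem_iff_pow_eq_one hB).trans (h _ _ hco2 hn2)
    -- As full solution sets, A and B are normal; their orders are coprime, so they commute
    -- elementwise and A × B embeds in G.
    have hdisj : Disjoint A B :=
      Subgroup.disjoint_of_coprime_natCard (by rwa [hcA, hcB])
    have hcomm : ∀ (x : A) (y : B), Commute (A.subtype x) (B.subtype y) := fun x y =>
      Subgroup.commute_of_normal_of_disjoint A B (normal_of_mem_iff_pow_eq_one hA)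
        (normal_of_mem_iff_pow_eq_one hB) hdisj x y x.2 y.2
    let F : A × B →* G := A.subtype.noncommCoprod B.subtype hcomm
    have hFinj : Function.Injective F := by
      rw [MonoidHom.noncommCoprod_injective]
      exact ⟨A.subtype_injective, B.subtype_injective, by simpa using hdisj⟩
    have hcard : Nat.card F.range = a * b := by
      rw [← hcA, ← hcB, ← Nat.card_prod]
      exact (Nat.card_congr (MonoidHom.ofInjective hFinj).toEquiv).symm
    exact ⟨F.range, Group.nilpotent_of_surjective F.rangeRestrict F.rangeRestrict_surjective,
      mem_iff_pow_eq_one_of_card hcard (h _ _ hmk hn')⟩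

/-- If `N` is nilpotent and is the only subgroup of its order, then it contains all elements of
`G` whose order divides that of `N`. -/
theorem mem_of_pow_card_eq_one {G : Type*} [Group G] [Finite G] (N : Subgroup G)
    [Group.IsNilpotent N] (hN : ∀ H : Subgroup G, Nat.card H = Nat.card N → H = N) {x : G}
    (hx : x ^ Nat.card N = 1) : x ∈ N := by
  have hNn : N.Normal := by
    have : N.Characteristic := Subgroup.characteristic_iff_map_eq.2 fun e =>
      hN _ (Subgroup.card_map_of_injective e.injective)
    infer_instance
  suffices key : ∀ m k : ℕ, m.Coprime k → m * k = Nat.card N → ∀ x : G, x ^ m = 1 → x ∈ N from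
    key _ 1 (Nat.coprime_one_right _) (mul_one _) x hx
  clear hx x
  intro m
  induction m using Nat.recOnPosPrimePosCoprime with
  | zero => intro k _ h; exact absurd (by rw [← h, zero_mul]) (Nat.card_pos (α := N)).ne'
  | one => intro k _ _ x hx; rw [show x = 1 by simpa using hx]; exact N.one_mem
  | prime_pow p v hp hv =>
    intro k hco hk x hx
    have := Fact.mk hp
    obtain ⟨j, hj, hxj⟩ := (Nat.dvd_prime_pow hp).1 (orderOf_dvd_of_pow_eq_one hx)
    -- Enlarge ⟨x⟩ to a p-group Q of order p^v. With A the part of N killed by k, which is normal in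
    -- G, the product QA has order p^v k = |N|, so by uniqueness it is N and contains x.
    obtain ⟨Q, hQ, hxQ⟩ := Sylow.exists_subgroup_card_pow_prime_le p
      ((Dvd.intro k hk).trans N.card_subgroup_dvd_card) (Subgroup.zpowers x)
      (by rw [Nat.card_zpowers, hxj]) hj
    obtain ⟨A, -, hA⟩ := exists_isNilpotent_of_powOneCount (G := N) dvd_rfl
      (fun a b hab h => powOneCount_of_isNilpotent N hab h) hco.symm ((mul_comm _ _).trans hk)
    have hAc : Nat.card A = k := (card_of_mem_iff_pow_eq_one hA).trans
      (powOneCount_of_isNilpotent N hco.symm ((mul_comm _ _).trans hk))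
    have hAG : (A.map N.subtype).Normal := by
      refine ⟨fun y hy g => ?_⟩
      obtain ⟨y, hy, rfl⟩ := hy
      refine ⟨⟨g * y * g⁻¹, hNn.conj_mem _ y.2 g⟩, (hA _).2 ?_, rfl⟩
      have h1 : (y : G) ^ k = 1 := by simpa using congrArg Subtype.val ((hA y).1 hy)
      ext
      simp [conj_pow, h1]
    have hAGc : Nat.card (A.map N.subtype) = k := by
      rw [Subgroup.card_map_of_injective N.subtype_injective, hAc]
    have hle : Nat.card (Q ⊔ A.map N.subtype : Subgroup G) ≤ p ^ v * k := by
      rw [← hQ, ← hAGc]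
      refine le_trans (le_of_eq ?_) (Set.natCard_mul_le (s := (Q : Set G)) (t := (A.map N.subtype : Set G)))
      rw [← Subgroup.mul_normal]
      rfl
    have hdvd : p ^ v * k ∣ Nat.card (Q ⊔ A.map N.subtype : Subgroup G) :=
      hco.mul_dvd_of_dvd_of_dvd (hQ ▸ Subgroup.card_dvd_of_le le_sup_left)
        (hAGc ▸ Subgroup.card_dvd_of_le le_sup_right)
    have heq := hN _ ((le_antisymm hle (Nat.le_of_dvd Nat.card_pos hdvd)).trans hk)
    exact heq ▸ Subgroup.mem_sup_left (hxQ (Subgroup.mem_zpowers x))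
  | coprime a b _ _ hab iha ihb =>
    intro k hco hk x hx
    obtain ⟨e, he⟩ := exists_powOneEquiv hab G
    have h1 := he (e.symm ⟨x, hx⟩)
    obtain ⟨ha, hb, -⟩ := (e.symm ⟨x, hx⟩).2
    rw [e.apply_symm_apply] at h1
    rw [show x = _ from h1]
    refine N.mul_mem (iha (b * k) ?_ ?_ _ ha) (ihb (a * k) ?_ ?_ _ hb)
    · exact hab.mul_right (hco.coprime_dvd_left (dvd_mul_right a b))
    · rw [← hk]; ring
    · exact hab.symm.mul_right (hco.coprime_dvd_left (dvd_mul_left b a))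
    · rw [← hk]; ring

/-- The relevant elements all lie in N, and the cyclic term depends only on n, not on the order of
the ambient group. -/
theorem TDiff_eq_TDiffTotal_of_forall_mem {G : Type*} [Group G] [Fintype G] (N : Subgroup G) [Fintype N]
    (hN : ∀ x : G, x ^ Nat.card N = 1 → x ∈ N) (r s : ℝ) :
    TDiff G (Nat.card N) r s = TDiffTotal N r s := by
  rw [TDiffTotal, ← Nat.card_eq_fintype_card, TDiff, TDiff, RSum_cyclicModel G, RSum_cyclicModel N]
  · congr 1
    symm
    refine Finset.sum_bij (fun x _ => (x : G)) ?_ (fun _ _ _ _ h => Subtype.ext h) ?_ ?_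
    · intro x hx
      simpa using (Finset.mem_filter.1 hx).2
    · intro x hx
      have h := (Finset.mem_filter.1 hx).2
      refine ⟨⟨x, hN x (orderOf_dvd_iff_pow_eq_one.1 h)⟩, ?_, rfl⟩
      simpa [Subgroup.orderOf_mk] using h
    · intro x _
      simp
  · rw [Nat.card_eq_fintype_card]
  · rw [← Nat.card_eq_fintype_card (α := G)]
    exact N.card_subgroup_dvd_card

/-- Here f(p^k) = (p/(p-1))^r < 1 for all k ≥ 1, so the weight is positive whenever m and n/m are
coprime. Vanishing then gives N(m) = m for these m, which is enough to build the nilpotent subgroup.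
-/
theorem TDiff_self_of_neg (G : Type*) [Group G] [Fintype G] {n : ℕ} (hn : n ∣ Fintype.card G)
    {r : ℝ} (hr : r < 0) :
    0 ≤ TDiff G n r r ∧ (TDiff G n r r = 0 ↔
      ∃ N : Subgroup G, Nat.card N = n ∧ (∀ H : Subgroup G, Nat.card H = n → H = N) ∧
        Group.IsNilpotent N) := by
  have hn' : n ∣ Nat.card G := by rwa [Nat.card_eq_fintype_card]
  have hn0 := ne_zero_of_dvd_ne_zero Fintype.card_ne_zero hn
  have hlt : ∀ p, p.Prime → orderTerm r r p < 1 := by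
    intro p hp
    have hp1 : (2 : ℝ) ≤ p := by exact_mod_cast hp.two_le
    have hq : (0 : ℝ) < (p : ℝ) - 1 := by linarith
    rw [orderTerm_prime r r hp, div_lt_one (Real.rpow_pos_of_pos hq r)]
    exact Real.rpow_lt_rpow_of_neg hq (by linarith) hr
  have hle : ∀ p k, p.Prime → orderTerm r r (p ^ (k + 1)) ≤ orderTerm r r (p ^ k) := by
    rintro p (_ | k) hp
    · simpa [orderTerm_one] using (hlt p hp).le
    · rw [orderTerm_prime_pow_succ r r hp]
      simp
  obtain ⟨h0, h1⟩ := TDiff_nonneg_and_eq_zero_iff G hn (r := r) (s := r) fun m _ =>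
    divisorWeight_nonneg (fun p k hp => (orderTerm_prime_pow_pos r r p k hp).le) hle
  refine ⟨h0, fun h => ?_, ?_⟩
  · have hH : ∀ a b, a.Coprime b → a * b = n → powOneCount G a = a := by
      rintro a b hab rfl
      refine h1.1 h a (dvd_mul_right a b)
        (divisorWeight_pos (orderTerm_prime_pow_pos r r) fun p hp hlt' => ?_).ne'
      have hpp := Nat.prime_of_mem_primeFactors hp
      have ha0 := left_ne_zero_of_mul hn0
      have hb0 := right_ne_zero_of_mul hn0
      rw [Nat.factorization_mul ha0 hb0, Finsupp.add_apply] at hlt'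
      have hpb : p ∣ b := (hpp.dvd_iff_one_le_factorization hb0).2 (by omega)
      have ha : a.factorization p = 0 := Nat.factorization_eq_zero_of_not_dvd fun hpa =>
        hpp.one_lt.ne' (Nat.eq_one_of_dvd_coprimes hab hpa hpb)
      rw [ha]
      simpa [orderTerm_one] using hlt p hpp
    obtain ⟨N, hNn, hN⟩ := exists_isNilpotent_of_powOneCount hn' hH (Nat.coprime_one_right n) (mul_one n)
    have hNc : Nat.card N = n := (card_of_mem_iff_pow_eq_one hN).trans
      (hH n 1 (Nat.coprime_one_right n) (mul_one n))
    refine ⟨N, hNc, fun H hH => ?_, hNn⟩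
    refine Subgroup.eq_of_le_of_card_ge (fun x hx => (hN x).2 ?_) (by rw [hNc, hH])
    exact orderOf_dvd_iff_pow_eq_one.1 (hH ▸ Subgroup.orderOf_dvd_natCard H hx)
  · rintro ⟨N, rfl, hu, hnil⟩
    have := Fintype.ofFinite N
    rw [TDiff_eq_TDiffTotal_of_forall_mem N fun x hx => mem_of_pow_card_eq_one N hu hx]
    exact TDiffTotal_self_of_isNilpotent N r

/-! ### The case r ≤ s - 1, s ≥ 1 -/

theorem mul_totient_le_mul_totient {d e : ℕ} (hde : d ∣ e) (he : e ≠ 0) :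
    d * e.totient ≤ e * d.totient := by
  suffices h : (d : ℚ) * e.totient ≤ e * d.totient by exact_mod_cast h
  rw [Nat.totient_eq_mul_prod_factors, Nat.totient_eq_mul_prod_factors, mul_left_comm]
  have hle : ∏ p ∈ e.primeFactors, (1 - (p : ℚ)⁻¹) ≤ ∏ p ∈ d.primeFactors, (1 - (p : ℚ)⁻¹) := by
    have hp : ∀ p ∈ e.primeFactors, (1 : ℚ) < p := fun p hp => by
      exact_mod_cast (Nat.prime_of_mem_primeFactors hp).one_lt
    have hsub := Nat.primeFactors_mono hde he
    rw [← Finset.prod_sdiff hsub]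
    refine mul_le_of_le_one_left (Finset.prod_nonneg fun p h => ?_)
      (Finset.prod_le_one (fun p h => ?_) fun p h => ?_)
    · exact sub_nonneg.2 (inv_le_one_of_one_le₀ (hp p (hsub h)).le)
    · exact sub_nonneg.2 (inv_le_one_of_one_le₀ (hp p (Finset.mem_sdiff.1 h).1).le)
    · have := inv_nonneg.2 (zero_le_one.trans (hp p (Finset.mem_sdiff.1 h).1).le)
      linarith
  gcongr

/-- φ(n)/n is a product of 1 - 1/q over primes q ≤ p, hence at least the telescoping product of 1 -
1/k over 2 ≤ k ≤ p, which is 1/p. -/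
theorem le_mul_totient {n p : ℕ} (hp : 1 ≤ p) (h : ∀ q ∈ n.primeFactors, q ≤ p) :
    n ≤ p * n.totient := by
  suffices h : (n : ℚ) ≤ p * n.totient by exact_mod_cast h
  have htel : ∀ m : ℕ, 1 ≤ m → ∏ k ∈ Finset.Icc 2 m, (1 - (k : ℚ)⁻¹) = (m : ℚ)⁻¹ := by
    intro m hm
    induction m, hm using Nat.le_induction with
    | base => simp
    | succ m hm ih =>
      rw [Finset.prod_Icc_succ_top (by omega), ih]
      have : (m : ℚ) ≠ 0 := by positivity
      have : ((m + 1 : ℕ) : ℚ) ≠ 0 := by positivity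
      field_simp
      push_cast
      ring
  have hsub : n.primeFactors ⊆ Finset.Icc 2 p := fun q hq =>
    Finset.mem_Icc.2 ⟨(Nat.prime_of_mem_primeFactors hq).two_le, h q hq⟩
  have hle : (p : ℚ)⁻¹ ≤ ∏ q ∈ n.primeFactors, (1 - (q : ℚ)⁻¹) := by
    have hk : ∀ k ∈ Finset.Icc 2 p, (1 : ℚ) ≤ k := fun k hk => by
      exact_mod_cast (by have := Finset.mem_Icc.1 hk; omega : 1 ≤ k)
    rw [← htel p hp, ← Finset.prod_sdiff hsub]
    refine mul_le_of_le_one_left (Finset.prod_nonneg fun q h => ?_)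
      (Finset.prod_le_one (fun q h => ?_) fun q h => ?_)
    · exact sub_nonneg.2 (inv_le_one_of_one_le₀ (hk q (hsub h)))
    · exact sub_nonneg.2 (inv_le_one_of_one_le₀ (hk q (Finset.mem_sdiff.1 h).1))
    · have := inv_nonneg.2 (zero_le_one.trans (hk q (Finset.mem_sdiff.1 h).1))
      linarith
  rw [Nat.totient_eq_mul_prod_factors]
  have hp0 : (0 : ℚ) < p := by positivity
  calc (n : ℚ) = p * (n * (p : ℚ)⁻¹) := by field_simp
    _ ≤ _ := by gcongr

/-- The sum of `f (orderOf x)` over the cyclic group of order `n`. -/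
noncomputable def cyclicSum (f : ℕ → ℝ) (n : ℕ) : ℝ := ∑ d ∈ n.divisors, d.totient * f d

theorem sum_orderOf_of_isCyclic (f : ℕ → ℝ) (H : Type*) [Group H] [Fintype H] [IsCyclic H] :
    ∑ x : H, f (orderOf x) = cyclicSum f (Nat.card H) := by
  classical
  rw [← Finset.sum_fiberwise_of_maps_to (g := fun x : H => orderOf x) (t := (Nat.card H).divisors)
    fun x _ => Nat.mem_divisors.2 ⟨orderOf_dvd_natCard x, Nat.card_pos.ne'⟩]
  refine Finset.sum_congr rfl fun d hd => ?_
  have hd := Nat.dvd_of_mem_divisors hd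
  rw [Nat.card_eq_fintype_card] at hd
  rw [Finset.sum_congr rfl fun x hx => by rw [(Finset.mem_filter.1 hx).2], Finset.sum_const,
    IsCyclic.card_orderOf_eq_totient hd, nsmul_eq_mul]

theorem cyclicSum_mul {f : ℕ → ℝ} (hf : ∀ a b : ℕ, a.Coprime b → f (a * b) = f a * f b) {a b : ℕ}
    (hab : a.Coprime b) : cyclicSum f (a * b) = cyclicSum f a * cyclicSum f b := by
  rw [cyclicSum, sum_divisors_mul_of_coprime hab, cyclicSum, cyclicSum, Finset.sum_mul_sum]
  refine Finset.sum_congr rfl fun x hx => Finset.sum_congr rfl fun y hy => ?_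
  have hxy : x.Coprime y := (hab.coprime_dvd_left (Nat.dvd_of_mem_divisors hx)).coprime_dvd_right
    (Nat.dvd_of_mem_divisors hy)
  rw [hf x y hxy, Nat.totient_mul hxy, Nat.cast_mul]
  ring

/-- Modulo ⟨a⟩ the product becomes b, so (ab)^o(b) lies in ⟨a⟩. -/
theorem orderOf_mul_dvd_of_normal_zpowers {G : Type*} [Group G] (a b : G)
    (ha : (Subgroup.zpowers a).Normal) : orderOf (a * b) ∣ orderOf a * orderOf b := by
  have h : (a * b) ^ orderOf b ∈ Subgroup.zpowers a := by
    rw [← QuotientGroup.eq_one_iff, QuotientGroup.mk_pow, QuotientGroup.mk_mul,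
      (QuotientGroup.eq_one_iff a).2 (Subgroup.mem_zpowers a), one_mul, ← QuotientGroup.mk_pow,
      pow_orderOf_eq_one, QuotientGroup.mk_one]
  refine orderOf_dvd_of_pow_eq_one ?_
  rw [mul_comm, pow_mul]
  exact orderOf_dvd_iff_pow_eq_one.1 (Nat.card_zpowers a ▸ Subgroup.orderOf_dvd_natCard _ h)

/-- Inside the cyclic group P, ⟨a⟩ is the solution set of y^o(a) = 1, a description invariant under
conjugation in G. -/
theorem normal_zpowers_of_mem_isCyclic {G : Type*} [Group G] [Finite G] (P : Subgroup G) [P.Normal]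
    [IsCyclic P] (a : P) : (Subgroup.zpowers (a : G)).Normal := by
  have h1 : ∀ y : P, y ∈ Subgroup.zpowers a ↔ y ^ orderOf a = 1 :=
    mem_iff_pow_eq_one_of_card (Nat.card_zpowers a) (powOneCount_of_isCyclic (orderOf_dvd_natCard a))
  have h2 : ∀ y : G, y ∈ Subgroup.zpowers (a : G) ↔ y ∈ P ∧ y ^ orderOf a = 1 := by
    intro y
    refine ⟨fun hy => ?_, fun ⟨hy, hy1⟩ => ?_⟩
    · obtain ⟨k, rfl⟩ := hy
      refine ⟨P.zpow_mem a.2 k, ?_⟩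
      have h := congrArg Subtype.val ((h1 (a ^ k)).1 ⟨k, rfl⟩)
      rwa [Subgroup.coe_pow, Subgroup.coe_zpow, Subgroup.coe_one] at h
    · obtain ⟨k, hk⟩ := (h1 ⟨y, hy⟩).2 (Subtype.ext (by simpa using hy1))
      exact ⟨k, by simpa using congrArg Subtype.val hk⟩
  refine ⟨fun y hy g => ?_⟩
  rw [h2] at hy ⊢
  exact ⟨Subgroup.Normal.conj_mem inferInstance y hy.1 g, by rw [conj_pow, hy.2]; simp⟩

/-- If `x` generates a subgroup of index less than the prime `p`, then the Sylow `p`-subgroup is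
cyclic and normal. -/
theorem exists_normal_isCyclic_sylow {G : Type*} [Group G] [Finite G] {p : ℕ} (hp : p.Prime) (x : G)
    (hx : (Subgroup.zpowers x).index < p) :
    ∃ P : Subgroup G, P.Normal ∧ IsCyclic P ∧ Nat.card P = p ^ (Nat.card G).factorization p := by
  have := Fact.mk hp
  have hci := (Subgroup.zpowers x).card_mul_index
  rw [Nat.card_zpowers] at hci
  have hi0 : (Subgroup.zpowers x).index ≠ 0 := Subgroup.index_ne_zero_of_finite
  -- An index below p is prime to p, so ⟨x⟩ contains a full Sylow p-subgroup, generated by a power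
  -- of x.
  have hdvd : p ^ (Nat.card G).factorization p ∣ orderOf x := by
    refine Nat.Coprime.dvd_of_dvd_mul_right (Nat.Coprime.pow_left _ ?_) (by rw [hci]; exact Nat.ordProj_dvd _ _)
    exact (Nat.Prime.coprime_iff_not_dvd hp).2 fun h =>
      absurd (Nat.le_of_dvd (Nat.pos_of_ne_zero hi0) h) (by omega)
  obtain ⟨c, hc⟩ := hdvd
  have hc0 : c ≠ 0 := by
    rintro rfl
    exact (orderOf_pos x).ne' (by simpa using hc)
  have hcard : Nat.card (Subgroup.zpowers (x ^ c)) = p ^ (Nat.card G).factorization p := by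
    rw [Nat.card_zpowers, orderOf_pow_of_dvd hc0 (hc ▸ dvd_mul_left _ _), hc]
    exact Nat.mul_div_cancel _ (Nat.pos_of_ne_zero hc0)
  let S : Sylow p G := Sylow.ofCard _ hcard
  have hS : (S : Subgroup G) = Subgroup.zpowers (x ^ c) := rfl
  have hle : Subgroup.zpowers x ≤ Subgroup.normalizer ((S : Subgroup G) : Set G) := by
    rw [Subgroup.zpowers_le, Subgroup.mem_normalizer_iff]
    intro h
    rw [hS]
    constructor
    · rintro ⟨k, rfl⟩
      exact ⟨k, by simp only; rw [(((Commute.refl x).pow_right c).zpow_right k).eq, mul_inv_cancel_right]⟩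
    · rintro ⟨k, hk⟩
      refine ⟨k, ?_⟩
      have h1 : h = x⁻¹ * (x * h * x⁻¹) * x := by group
      simp only at hk
      rw [h1, ← hk, mul_assoc, ← (((Commute.refl x).pow_right c).zpow_right k).eq, inv_mul_cancel_left]
  -- The number of Sylow p-subgroups is the index of this normalizer: it is below p and congruent to
  -- 1 mod p, hence 1.
  have hidx : (Subgroup.normalizer ((S : Subgroup G) : Set G)).index < p :=
    (Nat.le_of_dvd (Nat.pos_of_ne_zero hi0) (Subgroup.index_dvd_of_le hle)).trans_lt hx
  have hmod := card_sylow_modEq_one p G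
  have hone : Nat.card (Sylow p G) = 1 := by
    rw [S.card_eq_index_normalizer] at hmod ⊢
    change (Subgroup.normalizer ((S : Subgroup G) : Set G)).index = 1
    change (Subgroup.normalizer ((S : Subgroup G) : Set G)).index ≡ 1 [MOD p] at hmod
    have h2 : _ % p = 1 % p := hmod
    rwa [Nat.mod_eq_of_lt hidx, Nat.mod_eq_of_lt hp.one_lt] at h2
  have hN : (S : Subgroup G).Normal := by
    rw [← Subgroup.normalizer_eq_top_iff, ← Subgroup.index_eq_one]
    exact S.card_eq_index_normalizer.symm.trans hone
  exact ⟨Subgroup.zpowers (x ^ c), hS ▸ hN, inferInstance, hcard⟩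

theorem cyclicSum_pos {f : ℕ → ℝ} (hf : ∀ d, d ≠ 0 → 0 < f d) {n : ℕ} (hn : n ≠ 0) :
    0 < cyclicSum f n :=
  Finset.sum_pos (fun d hd => mul_pos
    (by exact_mod_cast Nat.totient_pos.2 (Nat.pos_of_mem_divisors hd))
    (hf d (Nat.pos_of_mem_divisors hd).ne')) ⟨1, by simpa using hn⟩

/-- An averaging argument: if `f d / d` is monotone for divisibility and `∑ f (orderOf x)` is at least
as large as for a cyclic group, then some cyclic subgroup has small index. -/
theorem exists_index_zpowers_lt {f g : ℕ → ℝ} (hfg : ∀ d, f d = d * g d)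
    (hg : ∀ d, d ≠ 0 → 0 < g d) (hgm : ∀ d e, d ∣ e → e ≠ 0 → g d ≤ g e)
    {G : Type*} [Group G] [Fintype G] (hsum : cyclicSum f (Nat.card G) ≤ ∑ x : G, f (orderOf x))
    (h1 : Nat.card G ≠ 1) {p : ℕ} (hp : 1 ≤ p) (hmax : ∀ q ∈ (Nat.card G).primeFactors, q ≤ p) :
    ∃ x : G, (Subgroup.zpowers x).index < p := by
  by_contra hcon
  push Not at hcon
  set n := Nat.card G with hn
  have hn0 : n ≠ 0 := Nat.card_pos.ne'
  have hgn := hg n hn0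
  -- If all indices are at least p, then o(x) ≤ n/p ≤ φ(n) for every x, which bounds the whole sum
  -- by the contribution of the generators of a cyclic group of order n.
  have hle : ∑ x : G, f (orderOf x) ≤ n.totient * f n := by
    have hx : ∀ x ∈ (Finset.univ : Finset G), f (orderOf x) ≤ n.totient * g n := by
      intro x _
      rw [hfg]
      have h2 : orderOf x ≤ n.totient := by
        have h3 := (Subgroup.zpowers x).card_mul_index
        rw [Nat.card_zpowers, ← hn] at h3
        have h4 := le_mul_totient hp hmax
        have h5 := Nat.mul_le_mul_left (orderOf x) (hcon x)
        nlinarith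
      have h3 := hgm _ _ (orderOf_dvd_natCard x) hn0
      have h4 : (orderOf x : ℝ) ≤ n.totient := by exact_mod_cast h2
      have h5 := hg _ (orderOf_pos x).ne'
      gcongr
    refine (Finset.sum_le_card_nsmul _ _ _ hx).trans_eq ?_
    rw [Finset.card_univ, ← Nat.card_eq_fintype_card, nsmul_eq_mul, hfg]
    ring
  have hlt : n.totient * f n < cyclicSum f n := by
    rw [cyclicSum, ← Nat.cons_self_properDivisors hn0, Finset.sum_cons]
    refine lt_add_of_pos_right _ (Finset.sum_pos (fun d hd => ?_) ⟨1, ?_⟩)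
    · have hd0 : d ≠ 0 := (Nat.pos_of_mem_properDivisors hd).ne'
      have := hg d hd0
      have : 0 < d.totient := Nat.totient_pos.2 (Nat.pos_of_ne_zero hd0)
      have : 0 < d := Nat.pos_of_ne_zero hd0
      rw [hfg]
      positivity
    · exact Nat.mem_properDivisors.2 ⟨one_dvd _, by omega⟩
  linarith

/-- Take p to be the largest prime divisor and K a complement of the normal cyclic Sylow subgroup P.
Since o(ak) divides o(a)o(k) and f increases along divisibility, the sum over G is at most the
cyclic sum of |P| times the sum over K; so K inherits the hypothesis and is cyclic by induction.
Equality then holds termwise, and at a pair of generators it yields an element of order |G|. -/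
theorem isCyclic_of_cyclicSum_le {f g : ℕ → ℝ} (hfg : ∀ d, f d = d * g d)
    (hg : ∀ d, d ≠ 0 → 0 < g d) (hgm : ∀ d e, d ∣ e → e ≠ 0 → g d ≤ g e)
    (hf : ∀ a b : ℕ, a.Coprime b → f (a * b) = f a * f b)
    (G : Type*) [Group G] [Fintype G] (hsum : cyclicSum f (Nat.card G) ≤ ∑ x : G, f (orderOf x)) :
    IsCyclic G := by
  induction hn : Nat.card G using Nat.strong_induction_on generalizing G with
  | _ n ih =>
  subst hn
  by_cases h1 : Nat.card G = 1
  · have := (Nat.card_eq_one_iff_unique.1 h1).1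
    exact isCyclic_of_subsingleton
  have hfpos : ∀ d, d ≠ 0 → 0 < f d := fun d hd => by
    rw [hfg]
    exact mul_pos (by positivity) (hg d hd)
  have hflt : ∀ d e, d ∣ e → e ≠ 0 → d ≠ e → f d < f e := fun d e hde he hne => by
    rw [hfg, hfg]
    have hlt : (d : ℝ) < e := by
      exact_mod_cast lt_of_le_of_ne (Nat.le_of_dvd (Nat.pos_of_ne_zero he) hde) hne
    exact (mul_le_mul_of_nonneg_left (hgm d e hde he) (by positivity)).trans_lt
      (mul_lt_mul_of_pos_right hlt (hg e he))
  have hfle : ∀ d e, d ∣ e → e ≠ 0 → f d ≤ f e := fun d e hde he => by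
    by_cases hne : d = e
    · rw [hne]
    · exact (hflt d e hde he hne).le
  have hne : (Nat.card G).primeFactors.Nonempty :=
    Nat.nonempty_primeFactors.2 (by have := Nat.card_pos (α := G); omega)
  obtain ⟨p, hpm, hmax⟩ := (Nat.card G).primeFactors.exists_max_image id hne
  have hp := Nat.prime_of_mem_primeFactors hpm
  obtain ⟨x, hx⟩ := exists_index_zpowers_lt hfg hg hgm hsum h1 hp.one_le hmax
  obtain ⟨P, hPN, hPc, hP⟩ := exists_normal_isCyclic_sylow hp x hx
  have hP1 : 1 < Nat.card P := by
    rw [hP]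
    exact Nat.one_lt_pow (hp.factorization_pos_of_dvd Nat.card_pos.ne'
      (Nat.dvd_of_mem_primeFactors hpm)).ne' hp.one_lt
  have hco : (Nat.card P).Coprime P.index := by
    have h2 : P.index = Nat.card G / p ^ (Nat.card G).factorization p := by
      rw [← hP, ← P.card_mul_index, Nat.mul_div_cancel_left _ Nat.card_pos]
    rw [h2, hP]
    exact (Nat.coprime_ordCompl hp Nat.card_pos.ne').pow_left _
  obtain ⟨K, hK⟩ := Subgroup.exists_right_complement'_of_coprime hco
  have hPK : Nat.card P * Nat.card K = Nat.card G := hK.card_mul_card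
  have hcoK : (Nat.card P).Coprime (Nat.card K) := by
    rwa [← Nat.eq_of_mul_eq_mul_left Nat.card_pos (hPK.trans P.card_mul_index.symm)] at hco
  have := Fintype.ofFinite P
  have := Fintype.ofFinite K
  have hcoq : ∀ q : P × K, (orderOf q.1).Coprime (orderOf q.2) := fun q =>
    (hcoK.coprime_dvd_left (orderOf_dvd_natCard q.1)).coprime_dvd_right (orderOf_dvd_natCard q.2)
  have hG : ∑ x : G, f (orderOf x) = ∑ q : P × K, f (orderOf ((q.1 : G) * (q.2 : G))) :=
    (Function.Bijective.sum_comp hK fun x => f (orderOf x)).symm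
  have hq : ∀ q ∈ (Finset.univ : Finset (P × K)),
      f (orderOf ((q.1 : G) * (q.2 : G))) ≤ f (orderOf q.1 * orderOf q.2) := by
    intro q _
    refine hfle _ _ ?_ (mul_ne_zero (orderOf_pos _).ne' (orderOf_pos _).ne')
    rw [← Subgroup.orderOf_coe q.1, ← Subgroup.orderOf_coe q.2]
    exact orderOf_mul_dvd_of_normal_zpowers _ _ (normal_zpowers_of_mem_isCyclic P q.1)
  have hprod : ∑ q : P × K, f (orderOf q.1 * orderOf q.2) =
      cyclicSum f (Nat.card P) * ∑ k : K, f (orderOf k) := by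
    rw [← sum_orderOf_of_isCyclic f P, Finset.sum_mul_sum, ← Finset.sum_product']
    exact Finset.sum_congr rfl fun q _ => hf _ _ (hcoq q)
  have hcyc : cyclicSum f (Nat.card G) = cyclicSum f (Nat.card P) * cyclicSum f (Nat.card K) := by
    rw [← hPK, cyclicSum_mul hf hcoK]
  have hPpos := cyclicSum_pos hfpos (n := Nat.card P) Nat.card_pos.ne'
  have hKle : cyclicSum f (Nat.card K) ≤ ∑ k : K, f (orderOf k) := by
    refine le_of_mul_le_mul_left ?_ hPpos
    rw [← hcyc, ← hprod]
    exact hsum.trans (hG.trans_le (Finset.sum_le_sum hq))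
  have hKc : IsCyclic K := by
    refine ih _ ?_ K hKle rfl
    rw [← hPK]
    exact lt_mul_of_one_lt_left Nat.card_pos hP1
  have heq : ∑ q : P × K, f (orderOf ((q.1 : G) * (q.2 : G))) =
      ∑ q : P × K, f (orderOf q.1 * orderOf q.2) := by
    refine le_antisymm (Finset.sum_le_sum hq) ?_
    rw [hprod, sum_orderOf_of_isCyclic f K, ← hcyc, ← hG]
    exact hsum
  obtain ⟨a, ha⟩ := IsCyclic.exists_ofOrder_eq_natCard (α := P)
  obtain ⟨k, hk⟩ := IsCyclic.exists_ofOrder_eq_natCard (α := K)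
  have hak := (Finset.sum_eq_sum_iff_of_le hq).1 heq (a, k) (Finset.mem_univ _)
  simp only [ha, hk, hPK] at hak
  refine isCyclic_of_orderOf_eq_card ((a : G) * (k : G)) ?_
  by_contra hne'
  exact (hflt _ _ (orderOf_dvd_natCard _) Nat.card_pos.ne' hne').ne hak

theorem RSum_natCard (H : Type*) [Group H] [Fintype H] (r s : ℝ) :
    RSum H (Nat.card H) r s = ∑ x : H, orderTerm r s (orderOf x) := by
  rw [RSum, Finset.filter_true_of_mem fun x _ => orderOf_dvd_natCard x]
  rfl

theorem TDiffTotal_of_le_sub_one (G : Type*) [Group G] [Fintype G] {r s : ℝ} (hr : r ≤ s - 1)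
    (hs : 1 ≤ s) : TDiffTotal G r s ≤ 0 ∧ (TDiffTotal G r s = 0 ↔ IsCyclic G) := by
  have : IsCyclic (CyclicModel G) := inferInstanceAs (IsCyclic (Multiplicative (ZMod _)))
  have hT : TDiffTotal G r s =
      ∑ x : G, orderTerm r s (orderOf x) - cyclicSum (orderTerm r s) (Nat.card G) := by
    have h1 := RSum_natCard (CyclicModel G) r s
    rw [sum_orderOf_of_isCyclic, card_cyclicModel] at h1
    rw [TDiffTotal, TDiff, h1, ← RSum_natCard, Nat.card_eq_fintype_card]
  have hcyc : cyclicSum (orderTerm r s) (Nat.card G) ≤ ∑ x : G, orderTerm r s (orderOf x) →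
      IsCyclic G := by
    refine isCyclic_of_cyclicSum_le
      -- Both exponents s - 1 and s - 1 - r are nonnegative, and both d/φ(d) and φ(d) grow along
      -- divisibility.
      (g := fun d => ((d : ℝ) / d.totient) ^ (s - 1) * (d.totient : ℝ) ^ (s - 1 - r))
      (fun d => ?_) (fun d hd => ?_) (fun d e hde he => ?_) (orderTerm_mul r s) G
    -- The factorization is also required at d = 0, where it holds because 0^s = 0 for s ≠ 0.
    · rcases Nat.eq_zero_or_pos d with rfl | hd
      · simp [orderTerm, Real.zero_rpow (by linarith : s ≠ 0)]
      have hφ : (0 : ℝ) < d.totient := by exact_mod_cast Nat.totient_pos.2 hd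
      have hd' : (0 : ℝ) < d := by exact_mod_cast hd
      rw [orderTerm, Real.div_rpow hd'.le hφ.le, Real.rpow_sub hφ (s - 1) r, Real.rpow_sub_one hd'.ne']
      have := Real.rpow_pos_of_pos hφ (s - 1)
      have := Real.rpow_pos_of_pos hφ r
      field_simp
    · have hφ : 0 < d.totient := Nat.totient_pos.2 (Nat.pos_of_ne_zero hd)
      positivity
    · have he' := Nat.pos_of_ne_zero he
      have hd' := Nat.pos_of_dvd_of_pos hde he'
      have hφd : (0 : ℝ) < d.totient := by exact_mod_cast Nat.totient_pos.2 hd'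
      have hφe : (0 : ℝ) < e.totient := by exact_mod_cast Nat.totient_pos.2 he'
      have h1 : (d : ℝ) / d.totient ≤ e / e.totient := by
        rw [div_le_div_iff₀ hφd hφe]
        exact_mod_cast mul_totient_le_mul_totient hde he
      have h2 : (d.totient : ℝ) ≤ e.totient := by
        exact_mod_cast Nat.le_of_dvd (Nat.totient_pos.2 he') (Nat.totient_dvd_of_dvd hde)
      exact mul_le_mul (Real.rpow_le_rpow (by positivity) h1 (by linarith))
        (Real.rpow_le_rpow hφd.le h2 (by linarith)) (by positivity) (by positivity)
  rw [hT]
  refine ⟨?_, fun h => hcyc (by linarith), fun h => ?_⟩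
  -- A positive difference would make G cyclic, and then the difference is zero.
  · by_contra hcon
    push Not at hcon
    have := hcyc (by linarith)
    rw [sum_orderOf_of_isCyclic, sub_self] at hcon
    exact lt_irrefl _ hcon
  · rw [sum_orderOf_of_isCyclic, sub_self]

theorem theorem1p4 {G : Type*} [Group G] [Fintype G] (n : ℕ) (hn : n ∣ Fintype.card G)
    (r s : ℝ) :
    (s < r → s ≤ 0 →
      0 ≤ TDiff G n r s ∧
        (TDiff G n r s = 0 ↔
          ∀ m : ℕ, m ∣ n → ∃! H : Subgroup G, IsCyclic H ∧ Nat.card H = m)) ∧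
    (s = r → r < 0 →
      0 ≤ TDiff G n r s ∧
        (TDiff G n r s = 0 ↔
          ∃ N : Subgroup G, Nat.card N = n ∧ (∀ H : Subgroup G, Nat.card H = n → H = N) ∧
            Group.IsNilpotent N)) ∧
    (r ≤ s - 1 → 1 ≤ s →
      TDiffTotal G r s ≤ 0 ∧ (TDiffTotal G r s = 0 ↔ IsCyclic G)) ∧
    (Group.IsNilpotent G → ¬ IsCyclic G →
      SignType.sign (TDiffTotal G r s) = SignType.sign (r - s)) :=
  ⟨TDiff_of_lt_of_nonpos G hn, fun h hr => h ▸ TDiff_self_of_neg G hn (h ▸ hr),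
    TDiffTotal_of_le_sub_one G, fun _ hG => sign_TDiffTotal_of_isNilpotent G hG r s⟩
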